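/- Let $n=3$ or $n=4$, and for $m>0$ let $S_m(r)=\sqrt{8m(r-2m)}$ if $n=3$ and $S_m(r)=\sqrt{2m}\,\log\!\Big(\frac{r}{\sqrt{2m}}+\sqrt{\frac{r^2}{2m}-1}\Big)$ if $n=4$ (the Schwarzschild profile of mass $m$). Let $\Omega\subset\mathbb R^n$ be a bounded open set whose complement is connected ($\Omega=\emptyset$ is allowed: the entire case). Let $f\in C^{n+1}(\mathbb R^n\setminus\overline\Omega)\cap C^0(\mathbb R^n\setminus\Omega)$ have minimal boundary: $f$ is constant on each connected component of $\partial\Omega$, $|Df(x)|\to\infty$ as $x\to\partial\Omega$, and the graph of $f$ over $\mathbb R^n\setminus\Omega$ is, near its points over $\partial\Omega$, an embedded $C^1$ hypersurface with boundary in $\mathbb R^{n+1}$, its boundary being the part over $\partial\Omega$. Assume that: 1. (asymptotic flatness) as $|x|\to\infty$, $f(x)$ tends to a real constant or to $+\infty$ or $-\infty$, and $|Df(x)|\to0$; 2. the ADM mass of the graph, $$m=\frac{1}{2(n-1)\omega_{n-1}}\lim_{r\to\infty}\int_{|x|=r}\frac{1}{1+|Df|^2}\sum_{i,j}(f_{ii}f_j-f_{ij}f_i)\frac{x^j}{|x|}\,d\mathcal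 H^{n-1},$$ where $\omega_{n-1}$ is the volume of the unit $(n-1)$-sphere, exists as a real number and $m>0$; 3. the graph of $f$ over $\mathbb R^n\setminus\overline\Omega$ has nonnegative scalar curvature (for the metric $\delta_{ij}+f_if_j$), and its mean curvature vector points upward, that is, at every point it points upward or is zero, and it points upward somewhere; 4. for some $\Lambda\in\mathbb R$, as $|x|\to\infty$, $f(x)-(\Lambda+S_m(|x|))$ is $o(|x|^{1/2})$ if $n=3$ and $o(\log|x|)$ if $n=4$. Let $\bar f:\mathbb R^n\to\mathbb R$ be the extension of $f$ that is constant on each connected component of $\overline\Omega$, and put $\Omega_h=\{x\in\mathbb R^n:\bar f(x)<h\}$ and $B_r=\{|x|<r\}$. Then for every $r_1>(2m)^{1/(n-2)}$ and every $h_1\in\mathbb R$ with $B_{r_1}\subset\Omega_{h_1}$, $$\bar f(x)-h_1\le S_m(|x|)-S_m(r_1)\qquad\text{for all }|x|\ge r_1 .$$ -/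

import Mathlib

open Filter Topology MeasureTheory Asymptotics

noncomputable section

namespace GraphPMT

/-- The `i`-th partial derivative of a function on `ℝⁿ`. -/
def pderiv {n : ℕ} (i : Fin n) (φ : EuclideanSpace ℝ (Fin n) → ℝ)
    (x : EuclideanSpace ℝ (Fin n)) : ℝ :=
  fderiv ℝ φ x (EuclideanSpace.single i 1)

/-! ### Curvature of a Riemannian metric in coordinates -/

/-- Christoffel symbols
`Γᵏᵢⱼ = ½ ∑ₗ gᵏˡ (∂ᵢ gⱼₗ + ∂ⱼ gᵢₗ - ∂ₗ gᵢⱼ)` of a metric `g` given in coordinates. -/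
def christoffel {n : ℕ} (g : EuclideanSpace ℝ (Fin n) → Matrix (Fin n) (Fin n) ℝ)
    (k i j : Fin n) (x : EuclideanSpace ℝ (Fin n)) : ℝ :=
  (1 / 2) * ∑ l, (g x)⁻¹ k l *
    (pderiv i (fun y => g y j l) x + pderiv j (fun y => g y i l) x
      - pderiv l (fun y => g y i j) x)

/-- Ricci curvature
`Rᵢⱼ = ∑ₖ (∂ₖ Γᵏᵢⱼ - ∂ⱼ Γᵏᵢₖ + ∑ₗ (Γᵏₖₗ Γˡᵢⱼ - Γᵏⱼₗ Γˡᵢₖ))`. -/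
def ricci {n : ℕ} (g : EuclideanSpace ℝ (Fin n) → Matrix (Fin n) (Fin n) ℝ)
    (i j : Fin n) (x : EuclideanSpace ℝ (Fin n)) : ℝ :=
  ∑ k, (pderiv k (christoffel g k i j) x - pderiv j (christoffel g k i k) x
    + ∑ l, (christoffel g k k l x * christoffel g l i j x
      - christoffel g k j l x * christoffel g l i k x))

/-- Scalar curvature `R = ∑ᵢⱼ gⁱʲ Rᵢⱼ`. -/
def scalarCurvature {n : ℕ} (g : EuclideanSpace ℝ (Fin n) → Matrix (Fin n) (Fin n) ℝ)
    (x : EuclideanSpace ℝ (Fin n)) : ℝ :=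
  ∑ i, ∑ j, (g x)⁻¹ i j * ricci g i j x

/-! ### Geometry of the graph of a function -/

/-- The metric `gᵢⱼ = δᵢⱼ + fᵢ fⱼ` induced on the graph of `f` by the Euclidean metric of
`ℝⁿ⁺¹`, in the coordinates `x ↦ (x, f x)`. -/
def graphMetric {n : ℕ} (f : EuclideanSpace ℝ (Fin n) → ℝ) (x : EuclideanSpace ℝ (Fin n)) :
    Matrix (Fin n) (Fin n) ℝ :=
  Matrix.of fun i j => (if i = j then 1 else 0) + pderiv i f x * pderiv j f x

/-- The scalar mean curvature `H = ∑ᵢⱼ gⁱʲ fᵢⱼ / √(1 + |Df|²)` of the graph of `f` with respect to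
the upward unit normal `(-Df, 1) / √(1 + |Df|²)`. -/
def meanCurvature {n : ℕ} (f : EuclideanSpace ℝ (Fin n) → ℝ)
    (x : EuclideanSpace ℝ (Fin n)) : ℝ :=
  (∑ i, ∑ j, (graphMetric f x)⁻¹ i j * pderiv i (pderiv j f) x) / √(1 + ‖gradient f x‖ ^ 2)

/-- The mean curvature vector of the graph of `f` at `(x, f x)`: the scalar mean curvature times
the upward unit normal. -/
def meanCurvatureVector {n : ℕ} (f : EuclideanSpace ℝ (Fin n) → ℝ)
    (x : EuclideanSpace ℝ (Fin n)) : EuclideanSpace ℝ (Fin n) × ℝ :=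
  meanCurvature f x • ((√(1 + ‖gradient f x‖ ^ 2))⁻¹ • (-gradient f x, (1 : ℝ)))

/-- The mean curvature vector of the graph of `f` over `D` is pointing upward: at every point it
points upward or is zero, and it points upward somewhere. -/
def MeanCurvaturePointsUpward {n : ℕ} (f : EuclideanSpace ℝ (Fin n) → ℝ)
    (D : Set (EuclideanSpace ℝ (Fin n))) : Prop :=
  (∀ x ∈ D, 0 < (meanCurvatureVector f x).2 ∨ meanCurvatureVector f x = 0) ∧
    ∃ x ∈ D, 0 < (meanCurvatureVector f x).2

/-- The graph of `f` is asymptotically flat: `f` tends to a constant or to `±∞` at infinity, and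
`|Df|` tends to zero. -/
def AsymptoticallyFlat {n : ℕ} (f : EuclideanSpace ℝ (Fin n) → ℝ) : Prop :=
  ((∃ L : ℝ, Tendsto f (Bornology.cobounded _) (𝓝 L)) ∨
      Tendsto f (Bornology.cobounded _) atTop ∨ Tendsto f (Bornology.cobounded _) atBot) ∧
    Tendsto (fun x => ‖gradient f x‖) (Bornology.cobounded _) (𝓝 0)

/-- The `(n-1)`-dimensional volume `ω_{n-1}` of the unit sphere of `ℝⁿ`. -/
def sphereVolume (n : ℕ) : ℝ :=
  (μHE[n - 1] (Metric.sphere (0 : EuclideanSpace ℝ (Fin n)) 1)).toReal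

/-- The ADM mass of the graph of `f` is the real number `m`. -/
def HasADMMass {n : ℕ} (f : EuclideanSpace ℝ (Fin n) → ℝ) (m : ℝ) : Prop :=
  Tendsto (fun r : ℝ => 1 / (2 * ((n : ℝ) - 1) * sphereVolume n) *
      ∫ x in Metric.sphere (0 : EuclideanSpace ℝ (Fin n)) r,
        1 / (1 + ‖gradient f x‖ ^ 2) *
          ∑ i, ∑ j, (pderiv i (pderiv i f) x * pderiv j f x
            - pderiv j (pderiv i f) x * pderiv i f x) * (x j / ‖x‖) ∂μHE[n - 1])
    atTop (𝓝 m)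

/-- Near each boundary point, the graph of `f` over the complement of `Ω` is a `C¹` hypersurface
with boundary of `ℝⁿ⁺¹`, whose boundary is the part that lies over `∂Ω`: with `C¹` functions `G`
and `B` having linearly independent differentials, it is `{G = 0, B ≥ 0}` and its boundary is
`{G = 0, B = 0}`. -/
def IsHypersurfaceWithBoundary {n : ℕ} (Ω : Set (EuclideanSpace ℝ (Fin n)))
    (f : EuclideanSpace ℝ (Fin n) → ℝ) : Prop :=
  ∀ x₀ ∈ frontier Ω, ∃ (V : Set (EuclideanSpace ℝ (Fin n) × ℝ))
    (G B : EuclideanSpace ℝ (Fin n) × ℝ → ℝ),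
    IsOpen V ∧ (x₀, f x₀) ∈ V ∧ ContDiffOn ℝ 1 G V ∧ ContDiffOn ℝ 1 B V ∧
    LinearIndependent ℝ ![fderiv ℝ G (x₀, f x₀), fderiv ℝ B (x₀, f x₀)] ∧
    (∀ q ∈ V, (q.1 ∉ Ω ∧ q.2 = f q.1) ↔ (G q = 0 ∧ 0 ≤ B q)) ∧
    (∀ q ∈ V, (q.1 ∈ frontier Ω ∧ q.2 = f q.1) ↔ (G q = 0 ∧ B q = 0))

/-- The graph of `f` over the complement of `Ω` is `Cᵏ`, either entire (this is the case `Ω = ∅`)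
or with minimal boundary. Only the values of `f` on the complement of `Ω` matter. -/
structure EntireOrMinimalBoundary {n : ℕ} (k : ℕ) (Ω : Set (EuclideanSpace ℝ (Fin n)))
    (f : EuclideanSpace ℝ (Fin n) → ℝ) : Prop where
  isOpen : IsOpen Ω
  isBounded : Bornology.IsBounded Ω
  isConnected_compl : IsConnected Ωᶜ
  contDiffOn : ContDiffOn ℝ k f (closure Ω)ᶜ
  continuousOn : ContinuousOn f Ωᶜ
  const_on_boundary : ∀ x ∈ frontier Ω, ∀ y ∈ connectedComponentIn (frontier Ω) x, f y = f x
  gradient_blowup : ∀ y ∈ frontier Ω,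
    Tendsto (fun x => ‖gradient f x‖) (𝓝[(closure Ω)ᶜ] y) atTop
  hypersurface : IsHypersurfaceWithBoundary Ω f

/-- `fbar` is the extension of `f` from the complement of `Ω` to all of `ℝⁿ` that is constant on
each connected component of the closure of `Ω`. -/
def IsConstantExtension {n : ℕ} (Ω : Set (EuclideanSpace ℝ (Fin n)))
    (f fbar : EuclideanSpace ℝ (Fin n) → ℝ) : Prop :=
  (∀ x ∉ Ω, fbar x = f x) ∧
    ∀ x ∈ closure Ω, ∀ y ∈ connectedComponentIn (closure Ω) x, fbar y = fbar x

/-- The sublevel set `Ω_h = {fbar < h}`. -/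
def sublevel {n : ℕ} (fbar : EuclideanSpace ℝ (Fin n) → ℝ) (h : ℝ) :
    Set (EuclideanSpace ℝ (Fin n)) :=
  {x | fbar x < h}

/-- The Schwarzschild profile `S_m(r)` for `n = 3` and `n = 4` (it is used for no other `n`). -/
def schwarzschild (n : ℕ) (m r : ℝ) : ℝ :=
  if n = 3 then √(8 * m * (r - 2 * m))
  else √(2 * m) * Real.log (r / √(2 * m) + √(r ^ 2 / (2 * m) - 1))

end GraphPMT

end

/-!
Write `p = Df`, `h = D²f`, `W² = 1 + |p|²`, and let `g` be the metric of the graph. The Gauss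
equation reads `W² R = (tr g⁻¹h)² - tr (g⁻¹h)²` (`scalarCurvature_graphMetric`), so `R ≥ 0` together
with a mean curvature vector that does not point downward says that `A = g^{-1/2} h g^{-1/2}` has
Frobenius norm at most `tr A` (`gardingCone_hess`). Such matrices form a convex cone that contains
the positive semidefinite ones. Two consequences carry the proof.

* If `f` touches a radial function with positive slope from below, the radial function has
  nonnegative scalar curvature at the contact point (`radial_curvature_nonneg_of_isLocalMax`).
* The trace of `A` on every hyperplane is nonnegative, so the regular level sets of `f` are mean
  convex: no superlevel set touches a ball from inside at a regular point
  (`gradient_eq_zero_of_superlevel_inside_ball`).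

The Schwarzschild profile of mass `M` has zero scalar curvature, and multiplying it by `l < 1` makes
the curvature negative (`scaled_schwarzschild_curvature_neg`). With `M = m / l³` the scaled profile
`u` still grows faster than `f`, so `fbar - u(|x|)` attains its maximum over `|x| ≥ r₁`. If the
maximum is on `|x| = r₁`, the claim holds for `u`, and `l → 1` gives the theorem. A maximum farther
out cannot lie over the exterior of `Ω`, by the first consequence, nor at a point near which `fbar`
takes no smaller value, because `u` is increasing.

What remains is a maximum at a point of `∂Ω`. Straightening the graph there by the implicit function
theorem and using that its tangent space is vertical, one finds that the graph leaves the boundary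
either strictly upward or strictly downward (`boundary_local_structure`). The upward case is
excluded as before. In the downward case, let `E` be the component of the closure of `Ω` through the
point. Since the complement of `Ω` is connected, `E` has a connected boundary in the sense of
`unicoherence`, so the graph leaves downward at every boundary point of `E`, in particular at the
point of `E` farthest from the origin; but there a superlevel set of `f`, at a height slightly below
the boundary value, touches a ball from inside, contrary to the second consequence
(`EntireOrMinimalBoundary.not_leavesDownward`).
-/

namespace GraphPMT

section Curvature

open Matrix

variable {n : ℕ}

/-! ### Calculus of partial derivatives -/

lemma pderiv_congr {i : Fin n} {φ ψ : EuclideanSpace ℝ (Fin n) → ℝ}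
    {x : EuclideanSpace ℝ (Fin n)} (h : φ =ᶠ[𝓝 x] ψ) : pderiv i φ x = pderiv i ψ x := by
  simp only [pderiv, h.fderiv_eq]

lemma pderiv_const_add {i : Fin n} (c : ℝ) (φ : EuclideanSpace ℝ (Fin n) → ℝ)
    (x : EuclideanSpace ℝ (Fin n)) : pderiv i (fun y => c + φ y) x = pderiv i φ x := by
  simp only [pderiv, fderiv_const_add]

lemma pderiv_mul {i : Fin n} {φ ψ : EuclideanSpace ℝ (Fin n) → ℝ}
    {x : EuclideanSpace ℝ (Fin n)} (hφ : DifferentiableAt ℝ φ x) (hψ : DifferentiableAt ℝ ψ x) :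
    pderiv i (fun y => φ y * ψ y) x = pderiv i φ x * ψ x + φ x * pderiv i ψ x := by
  simp only [pderiv, fderiv_fun_mul hφ hψ, _root_.add_apply, _root_.smul_apply, smul_eq_mul]
  ring

lemma pderiv_inv {i : Fin n} {φ : EuclideanSpace ℝ (Fin n) → ℝ}
    {x : EuclideanSpace ℝ (Fin n)} (hφ : DifferentiableAt ℝ φ x) (h0 : φ x ≠ 0) :
    pderiv i (fun y => (φ y)⁻¹) x = -pderiv i φ x / φ x ^ 2 := by
  have := (hasDerivAt_inv h0).comp_hasFDerivAt x hφ.hasFDerivAt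
  have h2 : HasFDerivAt (fun y => (φ y)⁻¹) (-(φ x ^ 2)⁻¹ • fderiv ℝ φ x) x := this
  simp only [pderiv, h2.fderiv, _root_.smul_apply, smul_eq_mul]
  ring

lemma pderiv_sum {i : Fin n} {ι : Type*} {s : Finset ι}
    {φ : ι → EuclideanSpace ℝ (Fin n) → ℝ} {x : EuclideanSpace ℝ (Fin n)}
    (hφ : ∀ k ∈ s, DifferentiableAt ℝ (φ k) x) :
    pderiv i (fun y => ∑ k ∈ s, φ k y) x = ∑ k ∈ s, pderiv i (φ k) x := by
  simp only [pderiv, fderiv_fun_sum hφ, _root_.sum_apply]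

lemma contDiffAt_pderiv {k : ℕ} {i : Fin n} {φ : EuclideanSpace ℝ (Fin n) → ℝ}
    {x : EuclideanSpace ℝ (Fin n)} (h : ContDiffAt ℝ (k + 1 : ℕ) φ x) :
    ContDiffAt ℝ k (pderiv i φ) x :=
  (h.fderiv_right (m := k) (by norm_cast)).clm_apply contDiffAt_const

lemma eventually_contDiffAt {k : ℕ} {φ : EuclideanSpace ℝ (Fin n) → ℝ}
    {x : EuclideanSpace ℝ (Fin n)} (h : ContDiffAt ℝ k φ x) :
    ∀ᶠ y in 𝓝 x, ContDiffAt ℝ k φ y :=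
  h.eventually (by simp)

/-- Partial derivatives of a `C²` function commute. -/
lemma pderiv_comm {i j : Fin n} {φ : EuclideanSpace ℝ (Fin n) → ℝ}
    {x : EuclideanSpace ℝ (Fin n)} (h : ContDiffAt ℝ (2 : ℕ) φ x) :
    pderiv i (pderiv j φ) x = pderiv j (pderiv i φ) x := by
  have hs : IsSymmSndFDerivAt ℝ φ x := h.isSymmSndFDerivAt (by simp)
  have hd : DifferentiableAt ℝ (fderiv ℝ φ) x :=
    (h.fderiv_right (m := 1) (by norm_num)).differentiableAt (by simp)
  have key : ∀ a b : Fin n, pderiv a (pderiv b φ) x =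
      fderiv ℝ (fderiv ℝ φ) x (EuclideanSpace.single a 1) (EuclideanSpace.single b 1) := by
    intro a b
    have h1 : HasFDerivAt (pderiv b φ) ((ContinuousLinearMap.apply ℝ ℝ
        (EuclideanSpace.single b (1 : ℝ))).comp (fderiv ℝ (fderiv ℝ φ) x)) x :=
      (ContinuousLinearMap.apply ℝ ℝ (EuclideanSpace.single b (1 : ℝ))).hasFDerivAt.comp x
        hd.hasFDerivAt
    rw [pderiv, h1.fderiv]
    rfl
  rw [key, key]
  exact hs _ _

lemma gradient_apply {φ : EuclideanSpace ℝ (Fin n) → ℝ} (x : EuclideanSpace ℝ (Fin n))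
    (i : Fin n) : gradient φ x i = pderiv i φ x := by
  have h : inner ℝ (gradient φ x) (EuclideanSpace.single i (1 : ℝ)) = pderiv i φ x := by
    simp [gradient, pderiv]
  rw [← h, EuclideanSpace.inner_single_right]
  simp

/-! ### The Gauss equation for a graph -/

/-- The quantity `W² = 1 + |Df|²`. -/
noncomputable def areaSq (f : EuclideanSpace ℝ (Fin n) → ℝ) (x : EuclideanSpace ℝ (Fin n)) : ℝ :=
  1 + ∑ k, pderiv k f x * pderiv k f x

lemma areaSq_pos (f : EuclideanSpace ℝ (Fin n) → ℝ) (x : EuclideanSpace ℝ (Fin n)) :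
    0 < areaSq f x := by
  have : 0 ≤ ∑ k, pderiv k f x * pderiv k f x :=
    Finset.sum_nonneg fun k _ => mul_self_nonneg _
  unfold areaSq; linarith

/-- The Hessian matrix. -/
noncomputable def hess (f : EuclideanSpace ℝ (Fin n) → ℝ) (x : EuclideanSpace ℝ (Fin n)) :
    Matrix (Fin n) (Fin n) ℝ :=
  Matrix.of fun i j => pderiv i (pderiv j f) x

lemma hess_transpose {f : EuclideanSpace ℝ (Fin n) → ℝ} {x : EuclideanSpace ℝ (Fin n)}
    (h : ContDiffAt ℝ (2 : ℕ) f x) : (hess f x)ᵀ = hess f x := by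
  ext i j
  exact pderiv_comm h

/-- The inverse of the graph metric, `gⁱʲ = δᵢⱼ - fᵢ fⱼ / W²`. -/
lemma graphMetric_inv (f : EuclideanSpace ℝ (Fin n) → ℝ) (x : EuclideanSpace ℝ (Fin n)) :
    (graphMetric f x)⁻¹ = Matrix.of fun i j =>
      (if i = j then 1 else 0) - pderiv i f x * pderiv j f x * (areaSq f x)⁻¹ := by
  apply Matrix.inv_eq_right_inv
  have hw := (areaSq_pos f x).ne'
  ext i j
  have e : ∀ k, graphMetric f x i k *
      ((if k = j then 1 else 0) - pderiv k f x * pderiv j f x * (areaSq f x)⁻¹) =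
      (if i = k then (if k = j then 1 else 0) else 0)
      - (if i = k then pderiv k f x * pderiv j f x * (areaSq f x)⁻¹ else 0)
      + (if k = j then pderiv i f x * pderiv k f x else 0)
      - pderiv i f x * pderiv j f x * (areaSq f x)⁻¹ * (pderiv k f x * pderiv k f x) := by
    intro k
    simp only [graphMetric, Matrix.of_apply]
    split_ifs <;> ring
  have hs : ∑ k, pderiv k f x * pderiv k f x = areaSq f x - 1 := by simp [areaSq]
  simp only [Matrix.mul_apply, Matrix.of_apply, e, Finset.sum_sub_distrib, Finset.sum_add_distrib,
    ← Finset.mul_sum, hs, Finset.sum_ite_eq, Finset.sum_ite_eq', Finset.mem_univ, if_true,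
    Matrix.one_apply]
  field_simp
  ring

lemma areaSq_contDiffAt {k : ℕ} {f : EuclideanSpace ℝ (Fin n) → ℝ} {x : EuclideanSpace ℝ (Fin n)}
    (h : ContDiffAt ℝ (k + 1 : ℕ) f x) : ContDiffAt ℝ k (areaSq f) x :=
  contDiffAt_const.add <| ContDiffAt.sum fun _ _ =>
    (contDiffAt_pderiv h).mul (contDiffAt_pderiv h)

lemma pderiv_areaSq {f : EuclideanSpace ℝ (Fin n) → ℝ} {x : EuclideanSpace ℝ (Fin n)}
    (h : ContDiffAt ℝ (2 : ℕ) f x) (i : Fin n) :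
    pderiv i (areaSq f) x = 2 * ∑ l, pderiv l f x * pderiv i (pderiv l f) x := by
  have hd : ∀ k, DifferentiableAt ℝ (pderiv k f) x := fun k =>
    (contDiffAt_pderiv (k := 1) h).differentiableAt (by simp)
  unfold areaSq
  rw [pderiv_const_add, pderiv_sum fun k _ => (hd k).fun_mul (hd k), Finset.mul_sum]
  refine Finset.sum_congr rfl fun k _ => ?_
  rw [pderiv_mul (hd k) (hd k)]
  ring

/-- The Christoffel symbols of the graph metric, `Γᵏᵢⱼ = fₖ fᵢⱼ / W²`. -/
lemma christoffel_graphMetric {f : EuclideanSpace ℝ (Fin n) → ℝ} {x : EuclideanSpace ℝ (Fin n)}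
    (h : ContDiffAt ℝ (2 : ℕ) f x) (k i j : Fin n) :
    christoffel (graphMetric f) k i j x =
      pderiv k f x * (areaSq f x)⁻¹ * pderiv i (pderiv j f) x := by
  have hd : ∀ k, DifferentiableAt ℝ (pderiv k f) x := fun k =>
    (contDiffAt_pderiv (k := 1) h).differentiableAt (by simp)
  have hg : ∀ a b c, pderiv a (fun y => graphMetric f y b c) x =
      pderiv a (pderiv b f) x * pderiv c f x + pderiv b f x * pderiv a (pderiv c f) x := by
    intro a b c
    simp only [graphMetric, Matrix.of_apply]
    rw [pderiv_const_add, pderiv_mul (hd b) (hd c)]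
  have hw := (areaSq_pos f x).ne'
  have hs : ∑ k, pderiv k f x * pderiv k f x = areaSq f x - 1 := by simp [areaSq]
  have e : ∀ l, (graphMetric f x)⁻¹ k l * (pderiv i (fun y => graphMetric f y j l) x
      + pderiv j (fun y => graphMetric f y i l) x - pderiv l (fun y => graphMetric f y i j) x) =
      (if k = l then 2 * pderiv i (pderiv j f) x * pderiv l f x else 0)
      - 2 * pderiv k f x * (areaSq f x)⁻¹ * pderiv i (pderiv j f) x *
        (pderiv l f x * pderiv l f x) := by
    intro l
    rw [hg, hg, hg, graphMetric_inv, pderiv_comm (i := j) (j := i) h,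
      pderiv_comm (i := l) (j := i) h, pderiv_comm (i := l) (j := j) h, Matrix.of_apply]
    split_ifs <;> ring
  simp only [christoffel, e, Finset.sum_sub_distrib, ← Finset.mul_sum, hs, Finset.sum_ite_eq,
    Finset.mem_univ, if_true]
  field_simp
  ring

/-- The Ricci curvature of the graph metric, in terms of the Hessian `h` and the first derivatives:
`W² Rᵢⱼ = tr(g⁻¹h) hᵢⱼ - (h g⁻¹ h)ᵢⱼ`. The third derivatives of `f` cancel. -/
lemma ricci_graphMetric {f : EuclideanSpace ℝ (Fin n) → ℝ} {x : EuclideanSpace ℝ (Fin n)}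
    (h : ContDiffAt ℝ (3 : ℕ) f x) (i j : Fin n) :
    ricci (graphMetric f) i j x = (areaSq f x)⁻¹ *
      (((graphMetric f x)⁻¹ * hess f x).trace * hess f x i j
        - (hess f x * (graphMetric f x)⁻¹ * hess f x) i j) := by
  have h2 : ContDiffAt ℝ (2 : ℕ) f x := h.of_le (by norm_cast)
  have hd : ∀ k, DifferentiableAt ℝ (pderiv k f) x := fun k =>
    (contDiffAt_pderiv (k := 1) h2).differentiableAt (by simp)
  have hdd : ∀ k l, DifferentiableAt ℝ (pderiv k (pderiv l f)) x := fun k l =>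
    (contDiffAt_pderiv (k := 1) (contDiffAt_pderiv (k := 2) h)).differentiableAt (by simp)
  have hwd : DifferentiableAt ℝ (areaSq f) x :=
    (areaSq_contDiffAt (k := 1) h2).differentiableAt (by simp)
  have hw := (areaSq_pos f x).ne'
  have hwi : DifferentiableAt ℝ (fun y => (areaSq f y)⁻¹) x := hwd.inv hw
  have hchr : ∀ a k i j, pderiv a (christoffel (graphMetric f) k i j) x =
      (pderiv a (pderiv k f) x * (areaSq f x)⁻¹ + pderiv k f x *
        (-(2 * ∑ l, pderiv l f x * pderiv a (pderiv l f) x) / areaSq f x ^ 2)) *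
          pderiv i (pderiv j f) x
      + pderiv k f x * (areaSq f x)⁻¹ * pderiv a (pderiv i (pderiv j f)) x := by
    intro a k i j
    have hev : christoffel (graphMetric f) k i j =ᶠ[𝓝 x] fun y =>
        pderiv k f y * (areaSq f y)⁻¹ * pderiv i (pderiv j f) y := by
      filter_upwards [eventually_contDiffAt h2] with y hy
      exact christoffel_graphMetric hy k i j
    rw [pderiv_congr hev, pderiv_mul ((hd k).fun_mul hwi) (hdd i j), pderiv_mul (hd k) hwi,
      pderiv_inv hwd hw, pderiv_areaSq h2]
  have h3 : ∀ k, pderiv k (pderiv i (pderiv j f)) x = pderiv j (pderiv i (pderiv k f)) x := by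
    intro k
    have e1 : pderiv i (pderiv j f) =ᶠ[𝓝 x] pderiv j (pderiv i f) := by
      filter_upwards [eventually_contDiffAt h2] with y hy
      exact pderiv_comm hy
    have e2 : pderiv k (pderiv i f) =ᶠ[𝓝 x] pderiv i (pderiv k f) := by
      filter_upwards [eventually_contDiffAt h2] with y hy
      exact pderiv_comm hy
    rw [pderiv_congr e1, pderiv_comm (contDiffAt_pderiv (k := 2) h), pderiv_congr e2]
  set w := areaSq f x with hwdef
  set p : Fin n → ℝ := fun k => pderiv k f x with hp
  have hsymm : ∀ a b, hess f x a b = hess f x b a := fun a b => pderiv_comm h2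
  set H := hess f x with hH
  have hHe : ∀ a b, pderiv a (pderiv b f) x = H a b := fun a b => rfl
  set q : Fin n → ℝ := fun a => ∑ l, p l * H a l with hq
  have hricci : ricci (graphMetric f) i j x = ∑ k, (w⁻¹ * H i j * H k k
      - 2 * H i j * (w⁻¹) ^ 2 * (p k * q k) - w⁻¹ * (H i k * H k j)
      + 2 * (w⁻¹) ^ 2 * q j * (p k * H i k) + ((w⁻¹) ^ 2 * H i j * (p k * q k)
      - (w⁻¹) ^ 2 * q j * (p k * H i k))) := by
    refine Finset.sum_congr rfl fun k _ => ?_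
    have e1 : ∑ l, (christoffel (graphMetric f) k k l x * christoffel (graphMetric f) l i j x
        - christoffel (graphMetric f) k j l x * christoffel (graphMetric f) l i k x) =
        (w⁻¹) ^ 2 * H i j * (p k * q k) - (w⁻¹) ^ 2 * q j * (p k * H i k) := by
      simp only [christoffel_graphMetric h2, hHe, hq, Finset.mul_sum, Finset.sum_mul,
        ← Finset.sum_sub_distrib]
      refine Finset.sum_congr rfl fun l _ => ?_
      simp only [← hwdef, hp]
      ring
    have e2 : ∀ a, ∑ l, pderiv l f x * pderiv a (pderiv l f) x = q a := fun a => rfl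
    rw [e1, hchr, hchr, h3 k, e2, e2]
    simp only [hHe]
    have e3 : pderiv k f x = p k := rfl
    rw [e3, hsymm j k]
    ring
  have hqi : ∑ k, p k * H i k = q i := rfl
  set a := ∑ k, p k * q k with ha
  have hG : (graphMetric f x)⁻¹ = 1 - w⁻¹ • Matrix.vecMulVec p p := by
    rw [graphMetric_inv]
    ext a b
    simp [Matrix.one_apply, Matrix.vecMulVec_apply, ← hwdef, hp, mul_comm]
  have htr : ((graphMetric f x)⁻¹ * H).trace = ∑ k, H k k - w⁻¹ * a := by
    rw [hG, sub_mul, one_mul, Matrix.trace_sub, smul_mul_assoc, Matrix.trace_smul,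
      Matrix.vecMulVec_mul, Matrix.trace_vecMulVec, smul_eq_mul]
    congr 2
    simp only [dotProduct, Matrix.vecMul, ha, hq]
    refine Finset.sum_congr rfl fun k _ => ?_
    simp only [hsymm k]
  have hmm : (H * (graphMetric f x)⁻¹ * H) i j = ∑ k, H i k * H k j - w⁻¹ * (q i * q j) := by
    rw [hG, mul_sub, mul_one, sub_mul, Matrix.sub_apply, mul_smul_comm, smul_mul_assoc,
      Matrix.mul_vecMulVec, Matrix.vecMulVec_mul, Matrix.smul_apply, Matrix.vecMulVec_apply,
      Matrix.mul_apply, smul_eq_mul]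
    congr 3
    · simp only [dotProduct, Matrix.mulVec, hq, mul_comm]
    · simp only [dotProduct, Matrix.vecMul, hq, hsymm j]
  rw [hricci, htr, hmm]
  simp only [Finset.sum_sub_distrib, Finset.sum_add_distrib, ← Finset.mul_sum, hqi, ← ha]
  ring

/-- The Gauss equation `W² R = (tr g⁻¹h)² - tr (g⁻¹h)²` of a graph, `h` being the Hessian. -/
lemma scalarCurvature_graphMetric {f : EuclideanSpace ℝ (Fin n) → ℝ}
    {x : EuclideanSpace ℝ (Fin n)} (h : ContDiffAt ℝ (3 : ℕ) f x) :
    scalarCurvature (graphMetric f) x = (areaSq f x)⁻¹ *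
      (((graphMetric f x)⁻¹ * hess f x).trace ^ 2
        - ((graphMetric f x)⁻¹ * hess f x * ((graphMetric f x)⁻¹ * hess f x)).trace) := by
  have hs := hess_transpose (h.of_le (by norm_cast) : ContDiffAt ℝ (2 : ℕ) f x)
  set G := (graphMetric f x)⁻¹ with hG
  have hGs : Gᵀ = G := by
    rw [hG, graphMetric_inv]
    ext a b
    simp only [Matrix.transpose_apply, Matrix.of_apply, eq_comm (a := a) (b := b)]
    ring
  set H := hess f x
  have htr : ∀ A : Matrix (Fin n) (Fin n) ℝ, Aᵀ = A → ∑ i, ∑ j, G i j * A i j = (G * A).trace := by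
    intro A hA
    simp only [Matrix.trace, Matrix.diag_apply, Matrix.mul_apply]
    refine Finset.sum_congr rfl fun i _ => Finset.sum_congr rfl fun j _ => ?_
    rw [← Matrix.transpose_apply A, hA]
  have e1 := htr H hs
  have e2 := htr (H * G * H) (by simp only [Matrix.transpose_mul, hs, hGs, Matrix.mul_assoc])
  have : scalarCurvature (graphMetric f) x = (areaSq f x)⁻¹ * ((G * H).trace *
      (∑ i, ∑ j, G i j * H i j) - ∑ i, ∑ j, G i j * (H * G * H) i j) := by
    simp only [scalarCurvature, ricci_graphMetric h, Finset.mul_sum, ← Finset.sum_sub_distrib,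
      ← hG]
    refine Finset.sum_congr rfl fun i _ => Finset.sum_congr rfl fun j _ => ?_
    ring
  rw [this, e1, e2]
  simp only [Matrix.mul_assoc, pow_two]

/-! ### The cone of symmetric matrices with nonnegative trace and second symmetric function -/

/-- The closed Gårding cone of the second elementary symmetric function: the symmetric matrices
with `0 ≤ tr A` and `2 σ₂(A) = (tr A)² - tr A² ≥ 0`. Equivalently, the Frobenius norm of `A` is at
most `tr A`, so this is a convex cone. -/
structure GardingCone (A : Matrix (Fin n) (Fin n) ℝ) : Prop where
  symm : Aᵀ = A
  trace_nonneg : 0 ≤ A.trace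
  trace_sq_le : (A * A).trace ≤ A.trace ^ 2

lemma trace_mul_eq_sum {A B : Matrix (Fin n) (Fin n) ℝ} (hB : Bᵀ = B) :
    (A * B).trace = ∑ z : Fin n × Fin n, A z.1 z.2 * B z.1 z.2 := by
  rw [Fintype.sum_prod_type]
  simp only [Matrix.trace, Matrix.diag_apply, Matrix.mul_apply]
  refine Finset.sum_congr rfl fun i _ => Finset.sum_congr rfl fun j _ => ?_
  rw [← Matrix.transpose_apply B, hB]

/-- The Cauchy–Schwarz inequality for the Frobenius inner product. -/
lemma trace_mul_sq_le {A B : Matrix (Fin n) (Fin n) ℝ} (hA : Aᵀ = A) (hB : Bᵀ = B) :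
    (A * B).trace ^ 2 ≤ (A * A).trace * (B * B).trace := by
  rw [trace_mul_eq_sum hB, trace_mul_eq_sum hA, trace_mul_eq_sum hB]
  simpa only [pow_two] using Finset.sum_mul_sq_le_sq_mul_sq Finset.univ
    (fun z : Fin n × Fin n => A z.1 z.2) (fun z => B z.1 z.2)

lemma trace_mul_self_nonneg {A : Matrix (Fin n) (Fin n) ℝ} (hA : Aᵀ = A) :
    0 ≤ (A * A).trace := by
  rw [trace_mul_eq_sum hA]
  exact Finset.sum_nonneg fun z _ => mul_self_nonneg _

lemma GardingCone.add {A B : Matrix (Fin n) (Fin n) ℝ} (hA : GardingCone A)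
    (hB : GardingCone B) : GardingCone (A + B) := by
  refine ⟨by rw [transpose_add, hA.symm, hB.symm], ?_, ?_⟩
  · rw [trace_add]; exact add_nonneg hA.trace_nonneg hB.trace_nonneg
  · have h1 : (A * B).trace ≤ A.trace * B.trace := by
      refine le_of_sq_le_sq ?_ (mul_nonneg hA.trace_nonneg hB.trace_nonneg)
      calc (A * B).trace ^ 2 ≤ (A * A).trace * (B * B).trace := trace_mul_sq_le hA.symm hB.symm
        _ ≤ A.trace ^ 2 * B.trace ^ 2 :=
          mul_le_mul hA.trace_sq_le hB.trace_sq_le (trace_mul_self_nonneg hB.symm) (sq_nonneg _)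
        _ = _ := by ring
    have h2 : (B * A).trace = (A * B).trace := trace_mul_comm _ _
    have h3 := hA.trace_sq_le
    have h4 := hB.trace_sq_le
    simp only [mul_add, add_mul, trace_add, h2]
    nlinarith

open scoped MatrixOrder in
lemma gardingCone_of_posSemidef {A : Matrix (Fin n) (Fin n) ℝ} (hA : A.PosSemidef) :
    GardingCone A := by
  have hs : Aᵀ = A := by
    have := hA.isHermitian
    rwa [IsHermitian, conjTranspose_eq_transpose_of_trivial] at this
  refine ⟨hs, hA.trace_nonneg, ?_⟩
  obtain ⟨B, rfl⟩ := CStarAlgebra.nonneg_iff_eq_star_mul_self.1 hA.nonneg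
  rw [star_eq_conjTranspose] at hs ⊢
  rw [trace_mul_eq_sum hs, Fintype.sum_prod_type, pow_two, Matrix.trace, Finset.sum_mul_sum]
  refine Finset.sum_le_sum fun i _ => Finset.sum_le_sum fun j _ => ?_
  simp only [Matrix.mul_apply, conjTranspose_apply, star_trivial, diag_apply]
  simpa only [pow_two] using Finset.sum_mul_sq_le_sq_mul_sq Finset.univ (fun k => B k i)
    (fun k => B k j)

lemma trace_mul_vecMulVec (A : Matrix (Fin n) (Fin n) ℝ) (e : Fin n → ℝ) :
    (A * vecMulVec e e).trace = e ⬝ᵥ A *ᵥ e := by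
  rw [Matrix.mul_vecMulVec, trace_vecMulVec, dotProduct_comm]

/-- An element of the cone has nonnegative trace on every hyperplane `e^⊥`. -/
lemma GardingCone.dotProduct_mulVec_le_trace {A : Matrix (Fin n) (Fin n) ℝ} (hA : GardingCone A)
    {e : Fin n → ℝ} (he : e ⬝ᵥ e = 1) : e ⬝ᵥ A *ᵥ e ≤ A.trace := by
  refine le_of_sq_le_sq ?_ hA.trace_nonneg
  have hv : (vecMulVec e e)ᵀ = vecMulVec e e := transpose_vecMulVec _ _
  have h := trace_mul_sq_le hA.symm hv
  rw [trace_mul_vecMulVec, vecMulVec_mul_vecMulVec] at h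
  simp only [he, one_smul, trace_vecMulVec, mul_one] at h
  exact h.trans hA.trace_sq_le

/-! ### The normalized Hessian -/

/-- The positive square root of the inverse metric `1 - p pᵀ / (1 + |p|²)`. -/
noncomputable def sqrtInv (p : Fin n → ℝ) : Matrix (Fin n) (Fin n) ℝ :=
  1 - (√(1 + p ⬝ᵥ p) * (√(1 + p ⬝ᵥ p) + 1))⁻¹ • vecMulVec p p

lemma dotProduct_self_nonneg_real (p : Fin n → ℝ) : 0 ≤ p ⬝ᵥ p :=
  Finset.sum_nonneg fun _ _ => mul_self_nonneg _

lemma sqrtInv_transpose (p : Fin n → ℝ) : (sqrtInv p)ᵀ = sqrtInv p := by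
  simp [sqrtInv, transpose_vecMulVec]

lemma sqrtInv_mul_self (p : Fin n → ℝ) :
    sqrtInv p * sqrtInv p = 1 - (1 + p ⬝ᵥ p)⁻¹ • vecMulVec p p := by
  have hp := dotProduct_self_nonneg_real p
  set W := √(1 + p ⬝ᵥ p) with hW
  have hW0 : 0 < W := Real.sqrt_pos.2 (by linarith)
  have hW2 : 1 + p ⬝ᵥ p = W ^ 2 := (Real.sq_sqrt (by linarith)).symm
  have hpp : p ⬝ᵥ p = W ^ 2 - 1 := by linarith
  rw [sqrtInv, ← hW, hW2]
  simp only [sub_mul, mul_sub, one_mul, mul_one, smul_mul_assoc, mul_smul_comm,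
    vecMulVec_mul_vecMulVec, hpp]
  ext i j
  simp only [Matrix.sub_apply, Matrix.smul_apply, smul_eq_mul, vecMulVec_apply, Pi.smul_apply]
  field_simp
  ring

/-- The gradient as a plain vector. -/
noncomputable def gradVec (f : EuclideanSpace ℝ (Fin n) → ℝ) (x : EuclideanSpace ℝ (Fin n)) :
    Fin n → ℝ :=
  fun k => pderiv k f x

/-- Nonnegative scalar curvature and an upward (or zero) mean curvature vector put the second
fundamental form, written in an orthonormal frame and up to the factor `W`, in the cone. -/
lemma gardingCone_hess {f : EuclideanSpace ℝ (Fin n) → ℝ} {x : EuclideanSpace ℝ (Fin n)}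
    (h : ContDiffAt ℝ (3 : ℕ) f x) (hR : 0 ≤ scalarCurvature (graphMetric f) x)
    (hH : 0 < (meanCurvatureVector f x).2 ∨ meanCurvatureVector f x = 0) :
    GardingCone (sqrtInv (gradVec f x) * hess f x * sqrtInv (gradVec f x)) := by
  have hs := hess_transpose (h.of_le (by norm_cast) : ContDiffAt ℝ (2 : ℕ) f x)
  have hw := areaSq_pos f x
  have hG : (graphMetric f x)⁻¹ = sqrtInv (gradVec f x) * sqrtInv (gradVec f x) := by
    rw [sqrtInv_mul_self, graphMetric_inv]
    ext i j
    simp [Matrix.one_apply, vecMulVec_apply, gradVec, areaSq, dotProduct, mul_comm]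
  set S := sqrtInv (gradVec f x) with hS
  have hSt : Sᵀ = S := sqrtInv_transpose _
  have htr : (S * hess f x * S).trace = ((graphMetric f x)⁻¹ * hess f x).trace := by
    rw [hG, trace_mul_comm, Matrix.mul_assoc]
  refine ⟨by simp only [transpose_mul, hSt, hs, Matrix.mul_assoc], ?_, ?_⟩
  · have hW : 0 < √(1 + ‖gradient f x‖ ^ 2) := Real.sqrt_pos.2 (by positivity)
    have hmc : 0 ≤ meanCurvature f x := by
      have e : (meanCurvatureVector f x).2 =
          meanCurvature f x * (√(1 + ‖gradient f x‖ ^ 2))⁻¹ := by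
        simp [meanCurvatureVector]
      have : 0 ≤ (meanCurvatureVector f x).2 := by
        rcases hH with h0 | h0
        · exact h0.le
        · rw [h0]; exact le_rfl
      rw [e] at this
      exact nonneg_of_mul_nonneg_left this (inv_pos.2 hW)
    have hsum : (∑ i, ∑ j, (graphMetric f x)⁻¹ i j * pderiv i (pderiv j f) x) =
        ((graphMetric f x)⁻¹ * hess f x).trace := by
      rw [trace_mul_eq_sum hs, Fintype.sum_prod_type]
      rfl
    rw [meanCurvature, hsum, ← htr] at hmc
    have := mul_nonneg hmc hW.le
    rwa [div_mul_cancel₀ _ hW.ne'] at this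
  · rw [scalarCurvature_graphMetric h, hG] at hR
    have h1 := nonneg_of_mul_nonneg_right hR (inv_pos.2 hw)
    have e : (S * hess f x * S * (S * hess f x * S)).trace =
        (S * S * hess f x * (S * S * hess f x)).trace := by
      rw [show S * hess f x * S * (S * hess f x * S) =
        S * hess f x * S * S * hess f x * S by simp only [Matrix.mul_assoc], trace_mul_comm]
      simp only [Matrix.mul_assoc]
    rw [htr, hG, e]
    linarith

lemma trace_one_sub_vecMulVec {e : Fin n → ℝ} (he : e ⬝ᵥ e = 1) :
    (1 - vecMulVec e e : Matrix (Fin n) (Fin n) ℝ).trace = n - 1 := by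
  simp [trace_sub, trace_vecMulVec, he]

lemma isIdempotent_one_sub {e : Fin n → ℝ} (he : e ⬝ᵥ e = 1) :
    (1 - vecMulVec e e : Matrix (Fin n) (Fin n) ℝ) * (1 - vecMulVec e e) = 1 - vecMulVec e e := by
  simp [mul_sub, sub_mul, vecMulVec_mul_vecMulVec, he]

/-- If the gradient direction is `e`, then the Hessian cannot be negative definite on `e^⊥`: the
level sets of `f` are mean convex. -/
lemma not_hess_neg_on_orthogonal (hn : 2 ≤ n) {H : Matrix (Fin n) (Fin n) ℝ} {e : Fin n → ℝ}
    (he : e ⬝ᵥ e = 1) {s c : ℝ} (hc : 0 < c)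
    (hA : GardingCone (sqrtInv (s • e) * H * sqrtInv (s • e)))
    (hneg : ∀ v : Fin n → ℝ, v ⬝ᵥ e = 0 → v ⬝ᵥ H *ᵥ v ≤ -c * (v ⬝ᵥ v)) : False := by
  set S := sqrtInv (s • e) with hS
  set P : Matrix (Fin n) (Fin n) ℝ := 1 - vecMulVec e e with hP
  have hPP : P * P = P := isIdempotent_one_sub he
  have hPt : Pᵀ = P := by simp [hP, transpose_vecMulVec]
  have hPe : P * vecMulVec e e = 0 := by simp [hP, sub_mul, vecMulVec_mul_vecMulVec, he]
  have heP : vecMulVec e e * P = 0 := by simp [hP, mul_sub, vecMulVec_mul_vecMulVec, he]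
  have hSe : S = 1 - ((√(1 + (s • e) ⬝ᵥ (s • e)) * (√(1 + (s • e) ⬝ᵥ (s • e)) + 1))⁻¹ * (s * s))
      • vecMulVec e e := by
    rw [hS, sqrtInv]
    simp only [smul_vecMulVec, vecMulVec_smul, smul_smul]
  have hPS : P * S = P := by rw [hSe, mul_sub, mul_one, mul_smul_comm, hPe, smul_zero, sub_zero]
  have hSP : S * P = P := by rw [hSe, sub_mul, one_mul, smul_mul_assoc, heP, smul_zero, sub_zero]
  set A := S * H * S with hAdef
  have h1 : (P * A).trace = (P * H * P).trace := by
    rw [← hPP, Matrix.mul_assoc, trace_mul_comm, hAdef,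
      show P * (S * H * S) * P = (P * S) * H * (S * P) by simp only [Matrix.mul_assoc], hPS, hSP,
      hPP]
  have h2 : (P * H * P).trace = ∑ i, (P.col i) ⬝ᵥ H *ᵥ (P.col i) := by
    simp only [Matrix.trace, diag_apply]
    refine Finset.sum_congr rfl fun i _ => ?_
    rw [Matrix.mul_assoc, Matrix.mul_apply]
    have : ∀ j, P i j = P j i := fun j => by rw [← Matrix.transpose_apply P, hPt]
    simp only [dotProduct, mulVec, Matrix.col, this, Matrix.mul_apply, Matrix.transpose_apply]
  have h3 : ∑ i, (P.col i) ⬝ᵥ (P.col i) = (n : ℝ) - 1 := by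
    rw [← trace_one_sub_vecMulVec he, ← hP]
    nth_rewrite 3 [← hPP]
    simp only [Matrix.trace, diag_apply]
    refine Finset.sum_congr rfl fun i _ => ?_
    rw [Matrix.mul_apply]
    have : ∀ j, P i j = P j i := fun j => by rw [← Matrix.transpose_apply P, hPt]
    simp only [dotProduct, Matrix.col, this, Matrix.transpose_apply]
  have h4 : ∀ i, P.col i ⬝ᵥ e = 0 := by
    intro i
    have : (P *ᵥ e) = 0 := by
      rw [hP, sub_mulVec, one_mulVec, vecMulVec_mulVec, he]
      simp
    have h5 := congrFun this i
    have h6 : ∀ j, P i j = P j i := fun j => by rw [← Matrix.transpose_apply P, hPt]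
    simp only [mulVec, h6, Pi.zero_apply] at h5
    exact h5
  have h7 : (P * A).trace ≤ -c * ((n : ℝ) - 1) := by
    rw [h1, h2, ← h3, Finset.mul_sum]
    exact Finset.sum_le_sum fun i _ => hneg _ (h4 i)
  have h8 : (P * A).trace = A.trace - e ⬝ᵥ A *ᵥ e := by
    rw [hP, sub_mul, one_mul, trace_sub, trace_mul_comm _ A, trace_mul_vecMulVec]
  have h9 := hA.dotProduct_mulVec_le_trace he
  have hn' : (2 : ℝ) ≤ n := by exact_mod_cast hn
  nlinarith

/-- If the gradient is `s e` with `s > 0` and the Hessian lies below that of a radial function with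
first derivative `s` and second derivative `b` at radius `r`, then the radial function has
nonnegative scalar curvature there. -/
lemma radial_curvature_nonneg (hn : 2 ≤ n) {H : Matrix (Fin n) (Fin n) ℝ} (hHs : Hᵀ = H)
    {e : Fin n → ℝ} (he : e ⬝ᵥ e = 1) {s r b : ℝ} (hs : 0 < s) (hr : 0 < r)
    (hA : GardingCone (sqrtInv (s • e) * H * sqrtInv (s • e)))
    (hle : ∀ v : Fin n → ℝ, v ⬝ᵥ H *ᵥ v ≤
      s / r * (v ⬝ᵥ v - (v ⬝ᵥ e) ^ 2) + b * (v ⬝ᵥ e) ^ 2) :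
    0 ≤ ((n : ℝ) - 2) * (s / r) + 2 * (b / (1 + s ^ 2)) := by
  set S := sqrtInv (s • e) with hS
  set E : Matrix (Fin n) (Fin n) ℝ := vecMulVec e e with hE
  have hEE : E * E = E := by simp [hE, vecMulVec_mul_vecMulVec, he]
  have hEt : Eᵀ = E := transpose_vecMulVec _ _
  have hSt : Sᵀ = S := sqrtInv_transpose _
  have hSS : S * S = 1 - ((1 + s ^ 2)⁻¹ * (s * s)) • E := by
    rw [hS, sqrtInv_mul_self]
    simp only [smul_vecMulVec, vecMulVec_smul, smul_smul, smul_dotProduct,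
      dotProduct_smul, he, smul_eq_mul, mul_one, ← pow_two, ← hE]
  have hSE : S * E = E * S := by
    rw [hS, sqrtInv]
    simp only [smul_vecMulVec, vecMulVec_smul, smul_smul, ← hE, mul_sub, sub_mul, mul_smul_comm,
      smul_mul_assoc, mul_one, one_mul]
  set k : Matrix (Fin n) (Fin n) ℝ := (s / r) • (1 - E) + b • E with hk
  have hK : S * k * S = (s / r) • (1 - E) + (b / (1 + s ^ 2)) • E := by
    have hkS : k * S = S * k := by
      simp only [hk, add_mul, mul_add, smul_mul_assoc, mul_smul_comm, sub_mul, mul_sub, one_mul,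
        mul_one, hSE]
    rw [Matrix.mul_assoc, hkS, ← Matrix.mul_assoc, hSS, hk]
    simp only [sub_mul, mul_add, smul_mul_assoc, mul_smul_comm, mul_sub, one_mul, mul_one, hEE]
    have h0 : (1 + s ^ 2) ≠ 0 := by positivity
    have hb : b / (1 + s ^ 2) = b - b * ((1 + s ^ 2)⁻¹ * (s * s)) := by field_simp; ring
    rw [hb]
    module
  have hkt : kᵀ = k := by simp [hk, hEt]
  have hpos : (S * k * S - S * H * S).PosSemidef := by
    have h1 : (k - H).PosSemidef := by
      refine PosSemidef.of_dotProduct_mulVec_nonneg ?_ fun v => ?_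
      · rw [IsHermitian, conjTranspose_eq_transpose_of_trivial, transpose_sub, hkt, hHs]
      · have h2 : v ⬝ᵥ k *ᵥ v = s / r * (v ⬝ᵥ v - (v ⬝ᵥ e) ^ 2) + b * (v ⬝ᵥ e) ^ 2 := by
          simp only [hk, hE, add_mulVec, smul_mulVec, sub_mulVec, one_mulVec, vecMulVec_mulVec,
            dotProduct_add, dotProduct_smul, dotProduct_sub, smul_eq_mul, dotProduct_comm e v,
            op_smul_eq_smul]
          ring
        rw [star_trivial, sub_mulVec, dotProduct_sub, h2]
        linarith [hle v]
    have h3 := h1.conjTranspose_mul_mul_same S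
    rw [conjTranspose_eq_transpose_of_trivial, hSt] at h3
    simpa only [mul_sub, sub_mul] using h3
  have hcone : GardingCone (S * k * S) := by
    have := hA.add (gardingCone_of_posSemidef hpos)
    rwa [add_sub_cancel] at this
  rw [hK] at hcone
  set σ := s / r with hσ
  set β := b / (1 + s ^ 2) with hβ
  have hσ0 : 0 < σ := div_pos hs hr
  have hE1 : E.trace = 1 := by rw [hE, trace_vecMulVec, he]
  have htr : (σ • (1 - E) + β • E).trace = σ * (n - 1) + β := by
    simp [trace_add, trace_smul, trace_sub, hE1]
  have htr2 : ((σ • (1 - E) + β • E) * (σ • (1 - E) + β • E)).trace =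
      σ ^ 2 * (n - 1) + β ^ 2 := by
    have : (σ • (1 - E) + β • E) * (σ • (1 - E) + β • E) = σ ^ 2 • (1 - E) + β ^ 2 • E := by
      simp only [add_mul, mul_add, smul_mul_assoc, mul_smul_comm, sub_mul, mul_sub, one_mul,
        mul_one, hEE]
      module
    rw [this]
    simp [trace_add, trace_smul, trace_sub, hE1]
  have h1 := hcone.trace_sq_le
  rw [htr, htr2] at h1
  have hn' : (2 : ℝ) ≤ n := by exact_mod_cast hn
  by_contra! hcon
  have h2 : 0 < σ * ((n : ℝ) - 1) := mul_pos hσ0 (by linarith)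
  nlinarith [mul_neg_of_pos_of_neg h2 hcon]

/-! ### Second-order conditions at a touching point -/

/-- The second-order necessary condition for a local maximum of a function of one variable. -/
lemma second_deriv_nonpos_of_isLocalMax {φ φ' : ℝ → ℝ} {c : ℝ} (hmax : IsLocalMax φ 0)
    (h1 : ∀ᶠ t in 𝓝 (0 : ℝ), HasDerivAt φ (φ' t) t) (h2 : HasDerivAt φ' c 0) :
    φ' 0 = 0 ∧ c ≤ 0 := by
  have h0 : φ' 0 = 0 := hmax.hasDerivAt_eq_zero h1.self_of_nhds
  refine ⟨h0, ?_⟩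
  by_contra! hc
  have hd : deriv φ =ᶠ[𝓝 0] φ' := h1.mono fun t ht => ht.deriv
  have hdd : deriv (deriv φ) 0 = c := by rw [hd.deriv_eq, h2.deriv]
  -- a positive second derivative would make `0` a local minimum as well, and `φ` locally constant
  have hmin : IsLocalMin φ 0 := isLocalMin_of_deriv_deriv_pos (by rw [hdd]; exact hc)
    (by rw [hd.eq_of_nhds, h0]) h1.self_of_nhds.continuousAt
  have hconst : φ =ᶠ[𝓝 0] fun _ => φ 0 := by
    filter_upwards [hmax, hmin] with t ht ht' using le_antisymm ht ht'
  have hd0 : deriv φ =ᶠ[𝓝 0] fun _ => 0 := by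
    filter_upwards [hconst.eventuallyEq_nhds] with t ht
    rw [ht.deriv_eq, deriv_const]
  rw [hd0.deriv_eq, deriv_const] at hdd
  exact hc.ne hdd

lemma inner_eq_dotProduct (v w : EuclideanSpace ℝ (Fin n)) :
    inner ℝ v w = v.ofLp ⬝ᵥ w.ofLp := by
  simp [PiLp.inner_apply, dotProduct, mul_comm]

lemma eq_sum_single (v : EuclideanSpace ℝ (Fin n)) :
    v = ∑ i, v i • EuclideanSpace.single i (1 : ℝ) := by
  ext j
  simp [Pi.single_apply]

lemma fderiv_eq_dotProduct (f : EuclideanSpace ℝ (Fin n) → ℝ) (x v : EuclideanSpace ℝ (Fin n)) :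
    fderiv ℝ f x v = gradVec f x ⬝ᵥ v.ofLp := by
  conv_lhs => rw [eq_sum_single v]
  simp [map_sum, gradVec, pderiv, dotProduct, mul_comm]

/-- First and second derivatives of `f` along the parabola `t ↦ x + t v + t² w`. -/
lemma hasDerivAt_along_parabola {f : EuclideanSpace ℝ (Fin n) → ℝ} {x : EuclideanSpace ℝ (Fin n)}
    (h : ContDiffAt ℝ (2 : ℕ) f x) (v w : EuclideanSpace ℝ (Fin n)) :
    (∀ᶠ t in 𝓝 (0 : ℝ), HasDerivAt (fun t : ℝ => f (x + t • v + t ^ 2 • w))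
        (gradVec f (x + t • v + t ^ 2 • w) ⬝ᵥ (v + (2 * t) • w).ofLp) t) ∧
      HasDerivAt (fun t : ℝ => gradVec f (x + t • v + t ^ 2 • w) ⬝ᵥ (v + (2 * t) • w).ofLp)
        (v.ofLp ⬝ᵥ hess f x *ᵥ v.ofLp + 2 * (gradVec f x ⬝ᵥ w.ofLp)) 0 := by
  set γ : ℝ → EuclideanSpace ℝ (Fin n) := fun t => x + t • v + t ^ 2 • w with hγ
  have hγ0 : γ 0 = x := by simp [hγ]
  have hγd : ∀ t, HasDerivAt γ (v + (2 * t) • w) t := by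
    intro t
    have h1 : HasDerivAt (fun t : ℝ => t • v) ((1 : ℝ) • v) t := (hasDerivAt_id t).smul_const v
    have h2 : HasDerivAt (fun t : ℝ => t ^ 2 • w) ((2 * t) • w) t := by
      simpa using (hasDerivAt_pow 2 t).smul_const w
    exact (h1.const_add x).fun_add h2 |>.congr_deriv (by simp)
  have hγc : Tendsto γ (𝓝 0) (𝓝 x) := by
    have := (hγd 0).continuousAt.tendsto
    rwa [hγ0] at this
  refine ⟨?_, ?_⟩
  · filter_upwards [hγc.eventually (eventually_contDiffAt h)] with t ht
    have hd : DifferentiableAt ℝ f (γ t) := ht.differentiableAt (by simp)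
    have := hd.hasFDerivAt.comp_hasDerivAt t (hγd t)
    rwa [fderiv_eq_dotProduct] at this
  · have hp : ∀ j, HasDerivAt (fun t => pderiv j f (γ t)) (∑ i, v i * pderiv i (pderiv j f) x) 0 := by
      intro j
      have hd : DifferentiableAt ℝ (pderiv j f) (γ 0) := by
        rw [hγ0]
        exact (contDiffAt_pderiv (k := 1) h).differentiableAt (by simp)
      have := hd.hasFDerivAt.comp_hasDerivAt 0 (hγd 0)
      rw [fderiv_eq_dotProduct, hγ0] at this
      convert! this using 1
      simp [dotProduct, gradVec, mul_comm]
    have hv : ∀ j, HasDerivAt (fun t : ℝ => v j + (2 * t) * w j) (2 * w j) 0 := by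
      intro j
      simpa using (((hasDerivAt_id (0 : ℝ)).const_mul 2).mul_const (w j)).const_add (v j)
    have hs := HasDerivAt.fun_sum (u := Finset.univ) fun j _ => (hp j).mul (hv j)
    have hfun : (fun t : ℝ => gradVec f (γ t) ⬝ᵥ (v + (2 * t) • w).ofLp) =
        fun t => ∑ j, pderiv j f (γ t) * (v j + (2 * t) * w j) := by
      funext t
      simp [dotProduct, gradVec]
    rw [hfun]
    refine hs.congr_deriv ?_
    simp only [hγ0, mul_zero, zero_mul, add_zero, dotProduct, mulVec, hess, Matrix.of_apply,
      gradVec, Finset.sum_add_distrib, Finset.mul_sum, Finset.sum_mul]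
    congr 1
    · rw [Finset.sum_comm]
      exact Finset.sum_congr rfl fun i _ => Finset.sum_congr rfl fun j _ => by ring
    · exact Finset.sum_congr rfl fun i _ => by ring

/-- If `f` touches a radial function `u(|x|)` with `u' > 0` from below, and the second fundamental
form of its graph lies in the Gårding cone, then the radial function has nonnegative scalar
curvature at the point of contact. -/
lemma radial_curvature_nonneg_of_isLocalMax (hn : 2 ≤ n) {f : EuclideanSpace ℝ (Fin n) → ℝ}
    {x : EuclideanSpace ℝ (Fin n)} (h : ContDiffAt ℝ (2 : ℕ) f x)
    (hA : GardingCone (sqrtInv (gradVec f x) * hess f x * sqrtInv (gradVec f x)))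
    {u u₁ : ℝ → ℝ} {u₂ : ℝ} (hx : x ≠ 0)
    (hu : ∀ᶠ r in 𝓝 ‖x‖, HasDerivAt u (u₁ r) r) (hu₁ : HasDerivAt u₁ u₂ ‖x‖)
    (hpos : 0 < u₁ ‖x‖) (hmax : IsLocalMax (fun y => f y - u ‖y‖) x) :
    0 ≤ ((n : ℝ) - 2) * (u₁ ‖x‖ / ‖x‖) + 2 * (u₂ / (1 + u₁ ‖x‖ ^ 2)) := by
  have hr : 0 < ‖x‖ := norm_pos_iff.2 hx
  set r := ‖x‖ with hrdef
  set e : Fin n → ℝ := r⁻¹ • x.ofLp with he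
  have hxx : x.ofLp ⬝ᵥ x.ofLp = r ^ 2 := by
    rw [← inner_eq_dotProduct, real_inner_self_eq_norm_sq]
  have hee : e ⬝ᵥ e = 1 := by
    rw [he, smul_dotProduct, dotProduct_smul, hxx]
    simp only [smul_eq_mul]
    field_simp
  -- compare along every line through `x`
  have key : ∀ v : EuclideanSpace ℝ (Fin n), gradVec f x ⬝ᵥ v.ofLp = u₁ r * (v.ofLp ⬝ᵥ e) ∧
      v.ofLp ⬝ᵥ hess f x *ᵥ v.ofLp ≤
        u₁ r / r * (v.ofLp ⬝ᵥ v.ofLp - (v.ofLp ⬝ᵥ e) ^ 2) + u₂ * (v.ofLp ⬝ᵥ e) ^ 2 := by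
    intro v
    obtain ⟨hf1, hf2⟩ := hasDerivAt_along_parabola h v 0
    simp only [smul_zero, add_zero, WithLp.ofLp_zero, dotProduct_zero, mul_zero] at hf1 hf2
    have hγd : ∀ t : ℝ, HasDerivAt (fun t : ℝ => x + t • v) v t := by
      intro t
      simpa using ((hasDerivAt_id t).smul_const v).const_add x
    have hγ : Tendsto (fun t : ℝ => x + t • v) (𝓝 0) (𝓝 x) := by
      simpa using (hγd 0).continuousAt.tendsto
    have hρ : Tendsto (fun t : ℝ => ‖x + t • v‖) (𝓝 0) (𝓝 r) := hγ.norm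
    have hρd : ∀ t : ℝ, x + t • v ≠ 0 →
        HasDerivAt (fun t : ℝ => ‖x + t • v‖) (inner ℝ (x + t • v) v / ‖x + t • v‖) t := by
      intro t ht
      have h1 := (hγd t).norm_sq
      have h2 := h1.sqrt (by positivity)
      simp only [Real.sqrt_sq (norm_nonneg _)] at h2
      refine h2.congr_deriv ?_
      have : ‖x + t • v‖ ≠ 0 := norm_ne_zero_iff.2 ht
      field_simp
    have hne : ∀ᶠ t in 𝓝 (0 : ℝ), x + t • v ≠ 0 := hγ.eventually_ne hx
    have hφ : ∀ᶠ t in 𝓝 (0 : ℝ), HasDerivAt (fun t : ℝ => f (x + t • v) - u ‖x + t • v‖)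
        (gradVec f (x + t • v) ⬝ᵥ v.ofLp -
          u₁ ‖x + t • v‖ * (inner ℝ (x + t • v) v / ‖x + t • v‖)) t := by
      filter_upwards [hf1, hne, hρ.eventually hu] with t h1 h2 h3
      exact h1.sub (HasDerivAt.comp t h3 (hρd t h2))
    have hi : HasDerivAt (fun t : ℝ => inner ℝ (x + t • v) v) (inner ℝ v v) 0 := by
      simpa using (hγd 0).inner ℝ (hasDerivAt_const (0 : ℝ) v)
    have hx0 : x + (0 : ℝ) • v = x := by simp
    have hu₁' : HasDerivAt (fun t : ℝ => u₁ ‖x + t • v‖) (u₂ * (inner ℝ x v / r)) 0 := by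
      have h3 : HasDerivAt u₁ u₂ ‖x + (0 : ℝ) • v‖ := by rw [hx0]; exact hu₁
      have h4 := HasDerivAt.comp (0 : ℝ) h3 (hρd 0 (by rw [hx0]; exact hx))
      rw [hx0] at h4
      exact h4
    have hq := hi.fun_div (hρd 0 (by rw [hx0]; exact hx)) (by rw [hx0]; exact hr.ne')
    have hφ2 := hf2.fun_sub (hu₁'.fun_mul hq)
    have hmax' : IsLocalMax (fun t : ℝ => f (x + t • v) - u ‖x + t • v‖) 0 := by
      have : ∀ᶠ t in 𝓝 (0 : ℝ), f (x + t • v) - u ‖x + t • v‖ ≤ f x - u ‖x‖ :=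
        hγ.eventually hmax
      filter_upwards [this] with t ht
      simpa using ht
    obtain ⟨h5, h6⟩ := second_deriv_nonpos_of_isLocalMax hmax' hφ hφ2
    simp only [hx0, inner_eq_dotProduct] at h5 h6
    have hve : v.ofLp ⬝ᵥ e = x.ofLp ⬝ᵥ v.ofLp / r := by
      rw [he, dotProduct_smul, dotProduct_comm, smul_eq_mul]
      field_simp
    rw [← hrdef] at h5 h6
    refine ⟨by rw [hve]; linarith, ?_⟩
    refine (sub_nonpos.1 h6).trans (le_of_eq ?_)
    rw [hve]
    field_simp
    ring
  have hgrad : gradVec f x = u₁ r • e := by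
    funext i
    have := (key (EuclideanSpace.single i 1)).1
    simpa [mul_comm] using this
  rw [hgrad] at hA
  exact radial_curvature_nonneg hn (hess_transpose h) hee hpos hr hA
    fun v => (key (WithLp.toLp 2 v)).2

/-- If the second fundamental form of the graph lies in the Gårding cone, then no superlevel set
of `f` can touch a ball from inside at a regular point. -/
lemma gradient_eq_zero_of_superlevel_inside_ball (hn : 2 ≤ n)
    {f : EuclideanSpace ℝ (Fin n) → ℝ}
    {x q : EuclideanSpace ℝ (Fin n)} (h : ContDiffAt ℝ (2 : ℕ) f x)
    (hA : GardingCone (sqrtInv (gradVec f x) * hess f x * sqrtInv (gradVec f x)))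
    (hxq : x ≠ q) (hball : ∀ᶠ y in 𝓝 x, ‖x - q‖ ≤ ‖y - q‖ → f y ≤ f x) :
    gradient f x = 0 := by
  have hR : 0 < ‖x - q‖ := norm_pos_iff.2 (sub_ne_zero.2 hxq)
  set R := ‖x - q‖ with hRdef
  obtain ⟨E, hE⟩ : ∃ E : EuclideanSpace ℝ (Fin n), E = R⁻¹ • (x - q) := ⟨_, rfl⟩
  have hxqE : x - q = R • E := by rw [hE, smul_smul, mul_inv_cancel₀ hR.ne', one_smul]
  have hEE : inner ℝ E E = (1 : ℝ) := by
    rw [hE, inner_smul_left, inner_smul_right, real_inner_self_eq_norm_sq, ← hRdef]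
    simp only [conj_trivial]
    field_simp
  have hee : E.ofLp ⬝ᵥ E.ofLp = 1 := by rw [← inner_eq_dotProduct, hEE]
  have hcont : ∀ v w : EuclideanSpace ℝ (Fin n),
      Tendsto (fun t : ℝ => x + t • v + t ^ 2 • w) (𝓝 0) (𝓝 x) := by
    intro v w
    have : Continuous (fun t : ℝ => x + t • v + t ^ 2 • w) := by fun_prop
    simpa using this.tendsto 0
  -- curves that stay outside of the ball, to second order
  have hcurve : ∀ (v : EuclideanSpace ℝ (Fin n)) (s : ℝ), inner ℝ v E = (0 : ℝ) →
      2 * R * s ≤ ‖v‖ ^ 2 →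
      gradVec f x ⬝ᵥ v.ofLp = 0 ∧
        v.ofLp ⬝ᵥ hess f x *ᵥ v.ofLp - 2 * s * (gradVec f x ⬝ᵥ E.ofLp) ≤ 0 := by
    intro v s hv hs
    obtain ⟨h1, h2⟩ := hasDerivAt_along_parabola h v (-s • E)
    have hmax : IsLocalMax (fun t : ℝ => f (x + t • v + t ^ 2 • (-s • E))) 0 := by
      filter_upwards [(hcont v (-s • E)).eventually hball] with t ht
      have h3 : R ≤ ‖x + t • v + t ^ 2 • (-s • E) - q‖ := by
        refine le_of_sq_le_sq ?_ (norm_nonneg _)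
        have h4 : x + t • v + t ^ 2 • (-s • E) - q = (R - s * t ^ 2) • E + t • v := by
          rw [show x + t • v + t ^ 2 • (-s • E) - q = (x - q) + t • v + t ^ 2 • (-s • E) by abel,
            hxqE]
          module
        rw [h4, norm_add_sq_real, norm_smul, norm_smul, mul_pow, mul_pow, Real.norm_eq_abs,
          Real.norm_eq_abs, sq_abs, sq_abs, inner_smul_left, inner_smul_right,
          real_inner_comm, hv, ← real_inner_self_eq_norm_sq E, hEE]
        nlinarith [mul_nonneg (sub_nonneg.2 hs) (sq_nonneg t), sq_nonneg (s * t ^ 2)]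
      simpa using ht h3
    obtain ⟨h5, h6⟩ := second_deriv_nonpos_of_isLocalMax hmax h1 h2
    simp only [zero_smul, add_zero, mul_zero, ne_eq, OfNat.ofNat_ne_zero, not_false_eq_true,
      zero_pow] at h5
    refine ⟨h5, ?_⟩
    have h7 : gradVec f x ⬝ᵥ (-s • E).ofLp = -s * (gradVec f x ⬝ᵥ E.ofLp) := by
      rw [WithLp.ofLp_smul, dotProduct_smul, smul_eq_mul]
    rw [h7] at h6
    linarith
  set a := gradVec f x ⬝ᵥ E.ofLp with ha
  -- the gradient is radial
  have hgrad : gradVec f x = a • E.ofLp := by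
    have h1 : ∀ w : EuclideanSpace ℝ (Fin n), gradVec f x ⬝ᵥ w.ofLp = a * (w.ofLp ⬝ᵥ E.ofLp) := by
      intro w
      have h2 := (hcurve (w - inner ℝ w E • E) 0
        (by rw [inner_sub_left, inner_smul_left, hEE]; simp) (by simp)).1
      rw [WithLp.ofLp_sub, dotProduct_sub, WithLp.ofLp_smul, dotProduct_smul, smul_eq_mul, ← ha,
        inner_eq_dotProduct] at h2
      linarith
    funext i
    have := h1 (EuclideanSpace.single i 1)
    simpa [mul_comm] using this
  have ha0 : a ≤ 0 := by
    obtain ⟨h1, -⟩ := hasDerivAt_along_parabola h E 0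
    have h2 : HasDerivAt (fun t : ℝ => f (x + t • E)) a 0 := by
      have := h1.self_of_nhds
      simpa using this
    have h3 : ∀ᶠ t in 𝓝[>] (0 : ℝ), f (x + t • E) ≤ f x := by
      have h4 := (hcont E 0).eventually hball
      filter_upwards [nhdsWithin_le_nhds h4, self_mem_nhdsWithin] with t ht (ht0 : 0 < t)
      simp only [smul_zero, add_zero] at ht
      apply ht
      rw [add_sub_right_comm, hxqE, ← add_smul, norm_smul, Real.norm_eq_abs,
        abs_of_pos (by positivity)]
      have : ‖E‖ = 1 := by
        rw [← sq_eq_sq₀ (norm_nonneg _) zero_le_one, ← real_inner_self_eq_norm_sq, hEE, one_pow]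
      rw [this]
      linarith
    have h5 : Tendsto (fun t : ℝ => t⁻¹ * (f (x + t • E) - f x)) (𝓝[>] 0) (𝓝 a) := by
      have := h2.tendsto_slope_zero_right
      simpa using this
    refine le_of_tendsto h5 ?_
    filter_upwards [h3, self_mem_nhdsWithin] with t ht (ht0 : 0 < t)
    exact mul_nonpos_of_nonneg_of_nonpos (inv_nonneg.2 ht0.le) (by linarith)
  have ha1 : a = 0 := by
    by_contra hne
    have hlt : a < 0 := lt_of_le_of_ne ha0 hne
    rw [hgrad] at hA
    refine not_hess_neg_on_orthogonal hn hee (c := -a / R) (div_pos (by linarith) hR) hA ?_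
    intro v hv
    have h1 := (hcurve (WithLp.toLp 2 v) (‖WithLp.toLp 2 v‖ ^ 2 / (2 * R))
      (by rw [inner_eq_dotProduct]; exact hv) (by field_simp; exact le_rfl)).2
    rw [← real_inner_self_eq_norm_sq, inner_eq_dotProduct] at h1
    simp only at h1
    have h2 : -(-a / R) * (v ⬝ᵥ v) = 2 * (v ⬝ᵥ v / (2 * R)) * a := by field_simp
    rw [h2]
    linarith
  ext i
  rw [gradient_apply]
  have := congrFun hgrad i
  rw [ha1, zero_smul] at this
  exact this

end Curvature

/-! ### The Schwarzschild profile -/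

/-- The derivative `√(2m / (rⁿ⁻² - 2m))` of the Schwarzschild profile. -/
noncomputable def schwarzschildDeriv (n : ℕ) (m r : ℝ) : ℝ := √(2 * m / (r ^ (n - 2) - 2 * m))

lemma schwarzschildDeriv_pos {n : ℕ} {m r : ℝ} (hm : 0 < m) (hr : 2 * m < r ^ (n - 2)) :
    0 < schwarzschildDeriv n m r :=
  Real.sqrt_pos.2 (div_pos (by linarith) (by linarith))

lemma hasDerivAt_schwarzschild {n : ℕ} (hn : n = 3 ∨ n = 4) {m r : ℝ} (hm : 0 < m) (hr0 : 0 < r)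
    (hr : 2 * m < r ^ (n - 2)) :
    HasDerivAt (schwarzschild n m) (schwarzschildDeriv n m r) r := by
  rcases hn with rfl | rfl
  · simp only [Nat.reduceSub, pow_one] at hr
    have hd : 0 < r - 2 * m := by linarith
    have hfun : schwarzschild 3 m = fun r => √(8 * m * (r - 2 * m)) := by
      funext r; simp [schwarzschild]
    rw [hfun]
    have h1 : HasDerivAt (fun r : ℝ => 8 * m * (r - 2 * m)) (8 * m) r := by
      simpa using ((hasDerivAt_id r).sub_const (2 * m)).const_mul (8 * m)
    refine (h1.sqrt (by positivity)).congr_deriv ?_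
    simp only [schwarzschildDeriv, Nat.reduceSub, pow_one]
    rw [show 8 * m * (r - 2 * m) = (2 * (r - 2 * m)) ^ 2 * (2 * m / (r - 2 * m)) by
      field_simp; ring, Real.sqrt_mul (by positivity), Real.sqrt_sq (by positivity)]
    have h2 : 0 < √(2 * m / (r - 2 * m)) := Real.sqrt_pos.2 (by positivity)
    have h3 : √(2 * m / (r - 2 * m)) ^ 2 = 2 * m / (r - 2 * m) := Real.sq_sqrt (by positivity)
    rw [div_eq_iff (by positivity)]
    have h4 : √(2 * m / (r - 2 * m)) * (2 * (2 * (r - 2 * m) * √(2 * m / (r - 2 * m)))) =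
      4 * (r - 2 * m) * √(2 * m / (r - 2 * m)) ^ 2 := by ring
    rw [h4, h3]
    rw [mul_div_assoc', eq_div_iff hd.ne']
    ring
  · simp only [Nat.reduceSub] at hr
    have ha : 0 < √(2 * m) := Real.sqrt_pos.2 (by linarith)
    have ha2 : √(2 * m) ^ 2 = 2 * m := Real.sq_sqrt (by linarith)
    set a := √(2 * m) with hadef
    have hq : 0 < r ^ 2 / (2 * m) - 1 := by
      rw [sub_pos, lt_div_iff₀ (by linarith)]; linarith
    have hfun : schwarzschild 4 m = fun r => a * Real.log (r / a + √(r ^ 2 / (2 * m) - 1)) := by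
      funext r; simp [schwarzschild, hadef]
    rw [hfun]
    set Q := √(r ^ 2 / (2 * m) - 1) with hQdef
    have hQ : 0 < Q := Real.sqrt_pos.2 hq
    have h1 : HasDerivAt (fun r : ℝ => r ^ 2 / (2 * m) - 1) (2 * r / (2 * m)) r := by
      simpa using ((hasDerivAt_pow 2 r).div_const (2 * m)).sub_const 1
    have h2 : HasDerivAt (fun r : ℝ => r / a + √(r ^ 2 / (2 * m) - 1))
        (1 / a + 2 * r / (2 * m) / (2 * Q)) r :=
      ((hasDerivAt_id r).div_const a).add (h1.sqrt hq.ne')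
    have h3 : 0 < r / a + Q := by positivity
    refine ((h2.log h3.ne').const_mul a).congr_deriv
      (?_ : a * ((1 / a + 2 * r / (2 * m) / (2 * Q)) / (r / a + Q)) = _)
    have h4 : schwarzschildDeriv 4 m r = 1 / Q := by
      rw [schwarzschildDeriv, hQdef, one_div, ← Real.sqrt_inv]
      congr 1
      have : r ^ 2 - 2 * m ≠ 0 := by linarith
      have : r ^ 2 / (2 * m) - 1 ≠ 0 := hq.ne'
      field_simp
    rw [h4, ← ha2]
    field_simp
    ring

lemma hasDerivAt_schwarzschildDeriv {n : ℕ} (hn : n = 3 ∨ n = 4) {m r : ℝ} (hm : 0 < m)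
    (hr0 : 0 < r) (hr : 2 * m < r ^ (n - 2)) :
    HasDerivAt (schwarzschildDeriv n m) (-((n : ℝ) - 2) / (2 * r) * schwarzschildDeriv n m r *
      (1 + schwarzschildDeriv n m r ^ 2)) r := by
  have hd : 0 < r ^ (n - 2) - 2 * m := by linarith
  have h1 : HasDerivAt (fun r : ℝ => 2 * m / (r ^ (n - 2) - 2 * m))
      (-(2 * m * ((n - 2 : ℕ) * r ^ (n - 2 - 1))) / (r ^ (n - 2) - 2 * m) ^ 2) r := by
    refine (((hasDerivAt_const r (2 * m)).fun_div ((hasDerivAt_pow (n - 2) r).sub_const (2 * m))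
      hd.ne')).congr_deriv ?_
    ring
  have hv : 0 < 2 * m / (r ^ (n - 2) - 2 * m) := by positivity
  refine (h1.sqrt hv.ne').congr_deriv ?_
  have hs : schwarzschildDeriv n m r ^ 2 = 2 * m / (r ^ (n - 2) - 2 * m) := Real.sq_sqrt hv.le
  have hs0 := schwarzschildDeriv_pos hm hr
  change _ / (2 * schwarzschildDeriv n m r) = _
  rw [div_eq_iff (by positivity)]
  have : -((n : ℝ) - 2) / (2 * r) * schwarzschildDeriv n m r * (1 + schwarzschildDeriv n m r ^ 2) *
      (2 * schwarzschildDeriv n m r) =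
      -((n : ℝ) - 2) / r * (schwarzschildDeriv n m r ^ 2 * (1 + schwarzschildDeriv n m r ^ 2)) := by
    field_simp
  rw [this, hs]
  rcases hn with rfl | rfl
  · have hd' : r - 2 * m ≠ 0 := by simpa using hd.ne'
    norm_num
    field_simp
    ring
  · have hd' : r ^ 2 - 2 * m ≠ 0 := hd.ne'
    norm_num
    field_simp
    ring

lemma schwarzschild_strictMonoOn {n : ℕ} (hn : n = 3 ∨ n = 4) {m r₀ : ℝ} (hm : 0 < m)
    (hr0 : 0 < r₀) (hr : 2 * m < r₀ ^ (n - 2)) :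
    StrictMonoOn (schwarzschild n m) (Set.Ici r₀) := by
  have key : ∀ r ∈ Set.Ici r₀, HasDerivAt (schwarzschild n m) (schwarzschildDeriv n m r) r ∧
      0 < schwarzschildDeriv n m r := by
    intro r hrr
    have h1 : 2 * m < r ^ (n - 2) := hr.trans_le (pow_le_pow_left₀ hr0.le hrr _)
    exact ⟨hasDerivAt_schwarzschild hn hm (hr0.trans_le hrr) h1, schwarzschildDeriv_pos hm h1⟩
  refine strictMonoOn_of_deriv_pos (convex_Ici _)
    (fun r h => (key r h).1.continuousAt.continuousWithinAt) fun r h => ?_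
  obtain ⟨h1, h2⟩ := key r (interior_subset h)
  rwa [h1.deriv]

/-- Scaling the Schwarzschild profile vertically by a factor `< 1` makes its scalar curvature
negative. -/
lemma scaled_schwarzschild_curvature_neg {n : ℕ} (hn : n = 3 ∨ n = 4) {m r l : ℝ} (hm : 0 < m)
    (hr0 : 0 < r) (hr : 2 * m < r ^ (n - 2)) (hl0 : 0 < l) (hl1 : l < 1) :
    ((n : ℝ) - 2) * (l * schwarzschildDeriv n m r / r) +
      2 * (l * (-((n : ℝ) - 2) / (2 * r) * schwarzschildDeriv n m r *
        (1 + schwarzschildDeriv n m r ^ 2)) / (1 + (l * schwarzschildDeriv n m r) ^ 2)) < 0 := by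
  have hs := schwarzschildDeriv_pos hm hr
  set s := schwarzschildDeriv n m r
  have hn2 : 0 < (n : ℝ) - 2 := by rcases hn with rfl | rfl <;> norm_num
  have hden : 0 < 1 + (l * s) ^ 2 := by positivity
  have e : ((n : ℝ) - 2) * (l * s / r) + 2 * (l * (-((n : ℝ) - 2) / (2 * r) * s *
        (1 + s ^ 2)) / (1 + (l * s) ^ 2)) =
      -(((n : ℝ) - 2) * l * s ^ 3 * (1 - l ^ 2) / (r * (1 + (l * s) ^ 2))) := by
    field_simp
    ring
  rw [e, neg_lt_zero]
  have : 0 < 1 - l ^ 2 := by nlinarith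
  positivity

/-- A vertically scaled profile of larger mass eventually dominates every function that is
asymptotic to the profile of mass `m`, as soon as the leading coefficients are in this order. -/
lemma tendsto_sub_scaled_schwarzschild {n : ℕ} (hn : n = 3 ∨ n = 4)
    {f : EuclideanSpace ℝ (Fin n) → ℝ} {m M l Λ : ℝ} (hm : 0 < m) (hM : 0 < M) (hl : 0 < l)
    (hlM : m < l ^ 2 * M)
    (hS₃ : n = 3 → (fun x : EuclideanSpace ℝ (Fin n) => f x - (Λ + schwarzschild n m ‖x‖))
      =o[Bornology.cobounded (EuclideanSpace ℝ (Fin n))] fun x => ‖x‖ ^ (1 / 2 : ℝ))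
    (hS₄ : n = 4 → (fun x : EuclideanSpace ℝ (Fin n) => f x - (Λ + schwarzschild n m ‖x‖))
      =o[Bornology.cobounded (EuclideanSpace ℝ (Fin n))] fun x => Real.log ‖x‖) :
    Tendsto (fun x => f x - l * schwarzschild n M ‖x‖)
      (Bornology.cobounded (EuclideanSpace ℝ (Fin n))) atBot := by
  have hc : √m < l * √M := by
    rw [← Real.sqrt_sq hl.le, ← Real.sqrt_mul (sq_nonneg _)]
    exact Real.sqrt_lt_sqrt hm.le hlM
  -- `g` is the common growth rate
  obtain ⟨g, C, hg, hgo, hup, hlow⟩ : ∃ (g : ℝ → ℝ) (C : ℝ), Tendsto g atTop atTop ∧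
      (fun x : EuclideanSpace ℝ (Fin n) => f x - (Λ + schwarzschild n m ‖x‖))
        =o[Bornology.cobounded (EuclideanSpace ℝ (Fin n))] (fun x => g ‖x‖) ∧
      (∀ᶠ r in atTop, schwarzschild n m r ≤ √m * g r + C) ∧
      ∀ᶠ r in atTop, √M * g r - C ≤ schwarzschild n M r := by
    rcases hn with rfl | rfl
    · refine ⟨fun r => √8 * √r, √M * √8 * √(2 * M), ?_, ?_, ?_, ?_⟩
      · exact Real.tendsto_sqrt_atTop.const_mul_atTop (by positivity)
      · have h := hS₃ rfl
        simp only [← Real.sqrt_eq_rpow] at h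
        exact h.const_mul_right (by positivity)
      · filter_upwards [eventually_ge_atTop 0] with r hr
        have : √(8 * m * (r - 2 * m)) ≤ √m * (√8 * √r) := by
          rw [← Real.sqrt_mul (by norm_num), ← Real.sqrt_mul hm.le]
          exact Real.sqrt_le_sqrt (by nlinarith)
        simp only [schwarzschild, if_true]
        have : 0 ≤ √M * √8 * √(2 * M) := by positivity
        linarith
      · filter_upwards [eventually_ge_atTop (2 * M)] with r hr
        simp only [schwarzschild, if_true]
        have h1 : √r ≤ √(r - 2 * M) + √(2 * M) := by
          refine Real.sqrt_le_iff.2 ⟨by positivity, ?_⟩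
          have e1 := Real.sq_sqrt (show 0 ≤ r - 2 * M by linarith)
          have e2 := Real.sq_sqrt (show 0 ≤ 2 * M by linarith)
          nlinarith [Real.sqrt_nonneg (r - 2 * M), Real.sqrt_nonneg (2 * M)]
        have e8 : √(8 * M) = √8 * √M := Real.sqrt_mul (by norm_num) _
        rw [Real.sqrt_mul (show 0 ≤ 8 * M by positivity), e8]
        have h2 : 0 ≤ √M * √8 := by positivity
        nlinarith [mul_le_mul_of_nonneg_left h1 h2]
    · refine ⟨fun r => √2 * Real.log r, |√(2 * m) * Real.log (2 / √(2 * m))| +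
        |√(2 * M) * Real.log √(2 * M)|, ?_, ?_, ?_, ?_⟩
      · exact Real.tendsto_log_atTop.const_mul_atTop (by positivity)
      · exact (hS₄ rfl).const_mul_right (by positivity)
      · filter_upwards [eventually_gt_atTop 0] with r hr
        have ha : 0 < √(2 * m) := by positivity
        have h1 : √(r ^ 2 / (2 * m) - 1) ≤ r / √(2 * m) := by
          refine Real.sqrt_le_iff.2 ⟨by positivity, ?_⟩
          rw [div_pow, Real.sq_sqrt (by positivity)]
          linarith
        have h2 : Real.log (r / √(2 * m) + √(r ^ 2 / (2 * m) - 1)) ≤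
            Real.log (2 / √(2 * m)) + Real.log r := by
          rw [← Real.log_mul (by positivity) hr.ne']
          apply Real.log_le_log (by positivity)
          calc _ ≤ r / √(2 * m) + r / √(2 * m) := by linarith
            _ = _ := by ring
        have h3 := mul_le_mul_of_nonneg_left h2 ha.le
        have h4 : schwarzschild 4 m r =
            √(2 * m) * Real.log (r / √(2 * m) + √(r ^ 2 / (2 * m) - 1)) := by
          simp [schwarzschild]
        have h5 : √(2 * m) = √m * √2 := by rw [mul_comm, Real.sqrt_mul hm.le]
        have h6 : √(2 * m) * Real.log r = √m * (√2 * Real.log r) := by rw [h5]; ring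
        rw [h4]
        linarith [le_abs_self (√(2 * m) * Real.log (2 / √(2 * m))),
          abs_nonneg (√(2 * M) * Real.log √(2 * M))]
      · filter_upwards [eventually_gt_atTop 0] with r hr
        have ha : 0 < √(2 * M) := by positivity
        have h2 : Real.log r - Real.log √(2 * M) ≤
            Real.log (r / √(2 * M) + √(r ^ 2 / (2 * M) - 1)) := by
          rw [← Real.log_div hr.ne' ha.ne']
          exact Real.log_le_log (by positivity) (by linarith [Real.sqrt_nonneg (r ^ 2 / (2 * M) - 1)])
        have h3 := mul_le_mul_of_nonneg_left h2 ha.le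
        have h4 : schwarzschild 4 M r =
            √(2 * M) * Real.log (r / √(2 * M) + √(r ^ 2 / (2 * M) - 1)) := by
          simp [schwarzschild]
        have h5 : √(2 * M) = √M * √2 := by rw [mul_comm, Real.sqrt_mul hM.le]
        have h6 : √(2 * M) * Real.log r = √M * (√2 * Real.log r) := by rw [h5]; ring
        rw [h4]
        linarith [le_abs_self (√(2 * M) * Real.log √(2 * M)),
          abs_nonneg (√(2 * m) * Real.log (2 / √(2 * m)))]
  set δ := (l * √M - √m) / 2 with hδ
  have hδ0 : 0 < δ := by rw [hδ]; linarith
  have hnorm : Tendsto (fun x : EuclideanSpace ℝ (Fin n) => ‖x‖) (Bornology.cobounded _) atTop :=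
    tendsto_norm_cobounded_atTop
  have hgn := hg.comp hnorm
  have hlim : Tendsto (fun x : EuclideanSpace ℝ (Fin n) => (Λ + C + l * C) - δ * g ‖x‖)
      (Bornology.cobounded _) atBot :=
    tendsto_atBot_add_const_left _ _ (tendsto_neg_atTop_atBot.comp (hgn.const_mul_atTop hδ0))
  refine tendsto_atBot_mono' _ ?_ hlim
  filter_upwards [hgo.bound hδ0, hnorm.eventually hup, hnorm.eventually hlow,
    hgn.eventually (eventually_ge_atTop 0)] with x h1 h2 h3 h4
  have h4' : 0 ≤ g ‖x‖ := h4
  rw [Real.norm_eq_abs, Real.norm_eq_abs, abs_of_nonneg h4'] at h1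
  have h5 := (abs_le.1 h1).2
  have h6 := mul_le_mul_of_nonneg_left h3 hl.le
  have h7 : l * (√M * g ‖x‖ - C) = (2 * δ + √m) * g ‖x‖ - l * C := by rw [hδ]; ring
  rw [h7] at h6
  nlinarith

lemma tendsto_scaled_schwarzschild {n : ℕ} {m r : ℝ} (hm : 0 < m) (hr : 0 < r) :
    Tendsto (fun l : ℝ => l * schwarzschild n (m / l ^ 3) r) (𝓝 1) (𝓝 (schwarzschild n m r)) := by
  have hM : ContinuousAt (fun l : ℝ => m / l ^ 3) 1 :=
    continuousAt_const.div (continuousAt_id.pow 3) (by norm_num)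
  have h : ContinuousAt (fun l : ℝ => l * schwarzschild n (m / l ^ 3) r) 1 := by
    refine continuousAt_id.mul ?_
    by_cases h3 : n = 3
    · simp only [schwarzschild, h3, if_true]
      fun_prop
    · simp only [schwarzschild, h3, if_false]
      have ha : ContinuousAt (fun l : ℝ => √(2 * (m / l ^ 3))) 1 := by fun_prop
      have ha0 : 0 < √(2 * (m / (1 : ℝ) ^ 3)) := by simp; exact hm
      refine ha.mul (ContinuousAt.log ?_ ?_)
      · refine (continuousAt_const.div ha ha0.ne').add ?_
        refine ContinuousAt.sqrt (ContinuousAt.sub (continuousAt_const.div (by fun_prop) ?_)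
          continuousAt_const)
        simp; exact hm.ne'
      · have : 0 < r / √(2 * (m / (1 : ℝ) ^ 3)) := div_pos hr ha0
        positivity
  have := h.tendsto
  simpa using this

lemma two_mul_lt_pow {n : ℕ} (hn : n = 3 ∨ n = 4) {m r : ℝ} (hm : 0 < m)
    (hr : (2 * m) ^ (1 / ((n : ℝ) - 2)) < r) : 0 < r ∧ 2 * m < r ^ (n - 2) := by
  have h0 : 0 < r := (Real.rpow_pos_of_pos (by linarith) _).trans hr
  refine ⟨h0, ?_⟩
  rcases hn with rfl | rfl
  · norm_num at hr ⊢
    exact hr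
  · norm_num at hr ⊢
    rw [← Real.sqrt_eq_rpow] at hr
    rw [← Real.sq_sqrt (show 0 ≤ 2 * m by linarith)]
    exact pow_lt_pow_left₀ hr (Real.sqrt_nonneg _) two_ne_zero

/-! ### The graph near a boundary point -/

lemma range_prod_eq_top_of_linearIndependent {E : Type*} [NormedAddCommGroup E]
    [NormedSpace ℝ E] {a b : E →L[ℝ] ℝ} (h : LinearIndependent ℝ ![a, b]) :
    (a.prod b).range = ⊤ := by
  by_contra hne
  obtain ⟨φ, hφ0, hφ⟩ := Submodule.exists_le_ker_of_lt_top _ (lt_top_iff_ne_top.2 hne)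
  have hφe : ∀ s t : ℝ, φ (s, t) = φ (1, 0) * s + φ (0, 1) * t := by
    intro s t
    have : ((s, t) : ℝ × ℝ) = s • (1, 0) + t • (0, 1) := by simp
    rw [this, map_add, map_smul, map_smul, smul_eq_mul, smul_eq_mul, mul_comm, mul_comm t]
  have h0 : φ (1, 0) • a + φ (0, 1) • b = 0 := by
    ext v
    have : φ ((a.prod b) v) = 0 := hφ ⟨v, rfl⟩
    rw [ContinuousLinearMap.prod_apply, hφe] at this
    simpa only [_root_.add_apply, _root_.smul_apply, smul_eq_mul, _root_.zero_apply] using this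
  obtain ⟨h1, h2⟩ := LinearIndependent.pair_iff.1 h _ _ h0
  apply hφ0
  ext
  · simpa using h1
  · simpa using h2

/-- A map with surjective strict derivative is, in suitable local coordinates, a projection; the
coordinate change is strictly differentiable with invertible derivative. -/
lemma exists_straightening {E F : Type*} [NormedAddCommGroup E] [NormedSpace ℝ E]
    [CompleteSpace E] [NormedAddCommGroup F] [NormedSpace ℝ F] [FiniteDimensional ℝ F]
    {g : E → F} {g' : E →L[ℝ] F} {z : E}
    (hg : HasStrictFDerivAt g g' z) (hg' : g'.range = ⊤) :
    ∃ (K : Submodule ℝ E) (Φ : OpenPartialHomeomorph E (F × K)) (A : E ≃L[ℝ] F × K),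
      z ∈ Φ.source ∧ Φ z = (g z, 0) ∧ (∀ q, (Φ q).1 = g q) ∧ (∀ v, (A v).1 = g' v) ∧
      HasStrictFDerivAt Φ (A : E →L[ℝ] F × K) z := by
  have := FiniteDimensional.complete ℝ F
  let φ := HasStrictFDerivAt.implicitFunctionDataOfComplemented g g' hg hg'
    g'.ker_closedComplemented_of_finiteDimensional_range
  refine ⟨g'.ker, φ.toOpenPartialHomeomorph, φ.leftDeriv.equivProdOfSurjectiveOfIsCompl φ.rightDeriv
    φ.range_leftDeriv φ.range_rightDeriv φ.isCompl_ker,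
    φ.pt_mem_toOpenPartialHomeomorph_source, ?_, fun q => rfl, fun v => rfl,
    φ.hasStrictFDerivAt⟩
  have h : φ.toOpenPartialHomeomorph z = (g z, φ.rightFun z) := rfl
  rw [h]
  simp [φ]

/-- At a boundary point where the gradient of `f` blows up, the tangent space of the graph
is vertical: a defining function `G` of the graph has vanishing vertical derivative. -/
lemma fderiv_vertical_eq_zero {n : ℕ} {Ω : Set (EuclideanSpace ℝ (Fin n))}
    {f : EuclideanSpace ℝ (Fin n) → ℝ} {y : EuclideanSpace ℝ (Fin n)}
    {V : Set (EuclideanSpace ℝ (Fin n) × ℝ)} {G : EuclideanSpace ℝ (Fin n) × ℝ → ℝ}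
    (hdiff : ContDiffOn ℝ 1 f (closure Ω)ᶜ)
    (hgrad : Tendsto (fun x => ‖gradient f x‖) (𝓝[(closure Ω)ᶜ] y) atTop)
    (hV : IsOpen V) (hyV : (y, f y) ∈ V) (hG : ContDiffOn ℝ 1 G V)
    (hGzero : ∀ q ∈ V, q.1 ∉ Ω → q.2 = f q.1 → G q = 0)
    (hlim : ∃ᶠ q in 𝓝 (y, f y), q.1 ∈ (closure Ω)ᶜ ∧ q.2 = f q.1) :
    fderiv ℝ G (y, f y) (0, 1) = 0 := by
  have hcont : ContinuousAt (fderiv ℝ G) (y, f y) :=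
    (hG.contDiffAt (hV.mem_nhds hyV)).continuousAt_fderiv (by simp)
  have hopen : IsOpen (closure Ω)ᶜ := isClosed_closure.isOpen_compl
  -- differentiate `G (x, f x) = 0`
  have hbound : ∀ q ∈ V, q.1 ∈ (closure Ω)ᶜ → q.2 = f q.1 →
      ‖gradient f q.1‖ * |fderiv ℝ G q (0, 1)| ≤ ‖fderiv ℝ G q‖ := by
    rintro ⟨x, t⟩ hq hx (rfl : t = f x)
    have hfx : DifferentiableAt ℝ f x :=
      (hdiff.contDiffAt (hopen.mem_nhds hx)).differentiableAt (by simp)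
    have hGx : DifferentiableAt ℝ G (x, f x) :=
      (hG.contDiffAt (hV.mem_nhds hq)).differentiableAt (by simp)
    have hpair : HasFDerivAt (fun x' => (x', f x'))
        ((ContinuousLinearMap.id ℝ _).prod (fderiv ℝ f x)) x :=
      (hasFDerivAt_id x).prodMk hfx.hasFDerivAt
    have hcomp : HasFDerivAt (fun x' => G (x', f x')) _ x :=
      HasFDerivAt.comp x (g := G) (f := fun x' => (x', f x')) hGx.hasFDerivAt hpair
    have hev : (fun x' => G (x', f x')) =ᶠ[𝓝 x] fun _ => 0 := by
      filter_upwards [hpair.continuousAt.preimage_mem_nhds (hV.mem_nhds hq),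
        hopen.mem_nhds hx] with x' h1 h2
      exact hGzero _ h1 (fun h => h2 (subset_closure h)) rfl
    have hz := hcomp.unique ((hasFDerivAt_const (0 : ℝ) x).congr_of_eventuallyEq hev)
    have h3 := DFunLike.congr_fun hz (gradient f x)
    have h4 : fderiv ℝ f x (gradient f x) = ‖gradient f x‖ ^ 2 := by
      rw [← real_inner_self_eq_norm_sq]
      exact InnerProductSpace.toDual_symm_apply.symm
    simp only [ContinuousLinearMap.comp_apply, ContinuousLinearMap.prod_apply,
      ContinuousLinearMap.id_apply, h4, _root_.zero_apply] at h3
    set g := gradient f x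
    have h5 : ((g, ‖g‖ ^ 2) : EuclideanSpace ℝ (Fin n) × ℝ) = (g, 0) + ‖g‖ ^ 2 • (0, 1) := by simp
    rw [h5, map_add, map_smul, smul_eq_mul] at h3
    have h6 : ‖fderiv ℝ G (x, f x) (g, 0)‖ ≤ ‖fderiv ℝ G (x, f x)‖ * ‖g‖ := by
      simpa using (fderiv ℝ G (x, f x)).le_opNorm (g, 0)
    have h7 : fderiv ℝ G (x, f x) (g, 0) = -(‖g‖ ^ 2 * fderiv ℝ G (x, f x) (0, 1)) := by linarith
    rw [h7, norm_neg, norm_mul, Real.norm_eq_abs, Real.norm_eq_abs,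
      abs_of_nonneg (sq_nonneg _)] at h6
    rcases eq_or_lt_of_le (norm_nonneg g) with h8 | h8
    · rw [← h8, zero_mul]; exact norm_nonneg _
    · refine le_of_mul_le_mul_left ?_ h8
      calc _ = ‖g‖ ^ 2 * |fderiv ℝ G (x, f x) (0, 1)| := by ring
        _ ≤ _ := h6
        _ = _ := mul_comm _ _
  by_contra hne
  set a := fderiv ℝ G (y, f y) (0, 1) with ha
  have hapos : 0 < |a| := abs_pos.2 hne
  set C := ‖fderiv ℝ G (y, f y)‖ + 1 with hC
  have e1 : ∀ᶠ q in 𝓝 (y, f y), |a| / 2 < |fderiv ℝ G q (0, 1)| := by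
    have h1 : ContinuousAt (fun q => |fderiv ℝ G q (0, 1)|) (y, f y) :=
      (hcont.clm_apply continuousAt_const).abs
    exact h1.eventually (lt_mem_nhds (by simpa [← ha] using half_lt_self hapos))
  have e2 : ∀ᶠ q in 𝓝 (y, f y), ‖fderiv ℝ G q‖ < C :=
    hcont.norm.eventually (gt_mem_nhds (by rw [hC]; linarith))
  have e3 : ∀ᶠ q : EuclideanSpace ℝ (Fin n) × ℝ in 𝓝 (y, f y), q.1 ∈ (closure Ω)ᶜ →
      C / (|a| / 2) < ‖gradient f q.1‖ := by
    have h1 := hgrad.eventually (eventually_gt_atTop (C / (|a| / 2)))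
    rw [eventually_nhdsWithin_iff] at h1
    exact (continuous_fst.tendsto (y, f y)).eventually h1
  obtain ⟨q, ⟨hq1, hq2⟩, h1, h2, h3, h4⟩ :=
    (hlim.and_eventually (e1.and (e2.and (e3.and (hV.mem_nhds hyV))))).exists
  have h5 := hbound q h4 hq1 hq2
  have h6 := h3 hq1
  rw [div_lt_iff₀ (by linarith)] at h6
  have h7 : ‖gradient f q.1‖ * (|a| / 2) ≤ ‖gradient f q.1‖ * |fderiv ℝ G q (0, 1)| :=
    mul_le_mul_of_nonneg_left h1.le (norm_nonneg _)
  linarith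

/-- Local structure at a boundary point `y`: the boundary near `y` lies in one connected component,
and the graph leaves the boundary either strictly upward or strictly downward. -/
lemma boundary_local_structure {n : ℕ} {Ω : Set (EuclideanSpace ℝ (Fin n))}
    {f : EuclideanSpace ℝ (Fin n) → ℝ} {y : EuclideanSpace ℝ (Fin n)} (hΩ : IsOpen Ω)
    (hdiff : ContDiffOn ℝ 1 f (closure Ω)ᶜ) (hcont : ContinuousOn f Ωᶜ)
    (hconst : ∀ x ∈ frontier Ω, ∀ z ∈ connectedComponentIn (frontier Ω) x, f z = f x)
    (hgrad : Tendsto (fun x => ‖gradient f x‖) (𝓝[(closure Ω)ᶜ] y) atTop)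
    (hhyp : IsHypersurfaceWithBoundary Ω f) (hy : y ∈ frontier Ω) :
    y ∈ closure (closure Ω)ᶜ ∧ ∃ ε > 0,
      Metric.ball y ε ∩ frontier Ω ⊆ connectedComponentIn (frontier Ω) y ∧
      ((∀ x ∈ Metric.ball y ε \ closure Ω, f x < f y) ∨
        ∀ x ∈ Metric.ball y ε \ closure Ω, f y < f x) := by
  obtain ⟨V, G, B, hV, hyV, hG, hB, hli, hsurf, hbdry⟩ := hhyp y hy
  have hyΩ : y ∉ Ω := fun h => by
    rw [hΩ.frontier_eq] at hy; exact hy.2 h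
  have hfr : ∀ x ∉ Ω, x ∉ frontier Ω → x ∈ (closure Ω)ᶜ := by
    intro x h1 h2 h3
    exact h2 (by rw [hΩ.frontier_eq]; exact ⟨h3, h1⟩)
  set z : EuclideanSpace ℝ (Fin n) × ℝ := (y, f y) with hz
  have hGs : HasStrictFDerivAt G (fderiv ℝ G z) z :=
    (hG.contDiffAt (hV.mem_nhds hyV)).hasStrictFDerivAt (by simp)
  have hBs : HasStrictFDerivAt B (fderiv ℝ B z) z :=
    (hB.contDiffAt (hV.mem_nhds hyV)).hasStrictFDerivAt (by simp)
  obtain ⟨K, Φ, A, hzs, hΦz, hΦ1, hA1, hΦd⟩ :=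
    exists_straightening (hGs.prodMk hBs) (range_prod_eq_top_of_linearIndependent hli)
  obtain ⟨hGz, hBz⟩ := (hbdry z hyV).1 ⟨hy, rfl⟩
  have hΦz0 : Φ z = 0 := by rw [hΦz, hGz, hBz]; rfl
  have h0t : (0 : (ℝ × ℝ) × K) ∈ Φ.target := hΦz0 ▸ Φ.map_source hzs
  have hΨ0 : Φ.symm 0 = z := by rw [← hΦz0, Φ.left_inv hzs]
  have hΨd : HasStrictFDerivAt Φ.symm (A.symm : (ℝ × ℝ) × K →L[ℝ] _) 0 :=
    Φ.hasStrictFDerivAt_symm h0t (by rw [hΨ0]; exact hΦd)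
  have hΨcont : ContinuousAt Φ.symm 0 := hΨd.hasFDerivAt.continuousAt
  -- the height above the boundary value, in the straightened coordinates
  set κ : (ℝ × ℝ) × K → ℝ := fun p => (Φ.symm p).2 - f y with hκ
  set L : (ℝ × ℝ) × K →L[ℝ] ℝ := (ContinuousLinearMap.snd ℝ _ _).comp
    (A.symm : (ℝ × ℝ) × K →L[ℝ] EuclideanSpace ℝ (Fin n) × ℝ) with hL
  have hκd : HasStrictFDerivAt κ L 0 :=
    (hasStrictFDerivAt_snd.comp 0 hΨd).sub_const (f y)
  obtain ⟨δ, hδ, hδN⟩ : ∃ δ > 0, Metric.ball (0 : (ℝ × ℝ) × K) δ ⊆ Φ.target ∩ Φ.symm ⁻¹' V :=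
    Metric.mem_nhds_iff.1 (inter_mem (Φ.open_target.mem_nhds h0t)
      (hΨcont.preimage_mem_nhds (by rw [hΨ0]; exact hV.mem_nhds hyV)))
  have hGB : ∀ p ∈ Metric.ball (0 : (ℝ × ℝ) × K) δ,
      (G (Φ.symm p), B (Φ.symm p)) = p.1 := by
    intro p hp
    rw [← hΦ1 (Φ.symm p), Φ.right_inv (hδN hp).1]
  -- the boundary, in the straightened coordinates
  have hbd : ∀ w : K, ‖w‖ < δ → (Φ.symm ((0, 0), w)).1 ∈ connectedComponentIn (frontier Ω) y ∧
      κ ((0, 0), w) = 0 := by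
    have hmem : ∀ w : K, ‖w‖ < δ → (((0, 0), w) : (ℝ × ℝ) × K) ∈ Metric.ball 0 δ := by
      intro w hw
      rw [mem_ball_zero_iff, Prod.norm_def]
      exact max_lt (by simpa using hδ) hw
    have hfront : ∀ w : K, ‖w‖ < δ → (Φ.symm ((0, 0), w)).1 ∈ frontier Ω ∧
        (Φ.symm ((0, 0), w)).2 = f (Φ.symm ((0, 0), w)).1 := by
      intro w hw
      have h1 := hGB _ (hmem w hw)
      simp only [Prod.mk.injEq] at h1
      exact (hbdry _ (hδN (hmem w hw)).2).2 h1
    have hconn : IsPreconnected ((fun w : K => (Φ.symm ((0, 0), w)).1) '' Metric.ball 0 δ) := by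
      refine (convex_ball (0 : K) δ).isPreconnected.image _ ?_
      intro w hw
      have hw' := hmem w (mem_ball_zero_iff.1 hw)
      have h1 : ContinuousAt Φ.symm (((0, 0), w) : (ℝ × ℝ) × K) :=
        Φ.symm.continuousAt (hδN hw').1
      have h2 : ContinuousAt (fun w : K => (((0, 0), w) : (ℝ × ℝ) × K)) w := by fun_prop
      exact (ContinuousAt.fst (ContinuousAt.comp (f := fun w : K => (((0, 0), w) : (ℝ × ℝ) × K))
        h1 h2)).continuousWithinAt
    have hsub := hconn.subset_connectedComponentIn (x := y)
      ⟨0, Metric.mem_ball_self hδ, by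
        change (Φ.symm 0).1 = y
        rw [hΨ0]⟩
      (by
        rintro _ ⟨w, hw, rfl⟩
        exact (hfront w (mem_ball_zero_iff.1 hw)).1)
    intro w hw
    have h1 := hsub ⟨w, mem_ball_zero_iff.2 hw, rfl⟩
    refine ⟨h1, ?_⟩
    change (Φ.symm ((0, 0), w)).2 - f y = 0
    rw [(hfront w hw).2, hconst y hy _ h1, sub_self]
  -- points of the graph over the exterior
  have hext : ∀ p ∈ Metric.ball (0 : (ℝ × ℝ) × K) δ, p.1.1 = 0 → 0 < p.1.2 →
      (Φ.symm p).1 ∈ (closure Ω)ᶜ ∧ (Φ.symm p).2 = f (Φ.symm p).1 := by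
    intro p hp h1 h2
    have h3 := hGB p hp
    have h4 : G (Φ.symm p) = 0 := by rw [← h1, ← h3]
    have h5 : B (Φ.symm p) = p.1.2 := by rw [← h3]
    obtain ⟨h6, h7⟩ := (hsurf _ (hδN hp).2).2 ⟨h4, by rw [h5]; exact h2.le⟩
    refine ⟨hfr _ h6 fun h8 => ?_, h7⟩
    have := ((hbdry _ (hδN hp).2).1 ⟨h8, h7⟩).2
    linarith
  have hpath : Tendsto (fun s : ℝ => (((0, s), 0) : (ℝ × ℝ) × K)) (𝓝[>] 0) (𝓝 0) := by
    have : Continuous (fun s : ℝ => (((0, s), 0) : (ℝ × ℝ) × K)) := by fun_prop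
    exact (this.tendsto 0).mono_left nhdsWithin_le_nhds
  have hpathext : ∀ᶠ s : ℝ in 𝓝[>] 0, (Φ.symm ((0, s), 0)).1 ∈ (closure Ω)ᶜ ∧
      (Φ.symm ((0, s), 0)).2 = f (Φ.symm ((0, s), 0)).1 := by
    filter_upwards [hpath.eventually (Metric.ball_mem_nhds 0 hδ), self_mem_nhdsWithin]
      with s hs (hs0 : 0 < s)
    exact hext _ hs rfl hs0
  have hpathz : Tendsto (fun s : ℝ => Φ.symm (((0, s), 0) : (ℝ × ℝ) × K)) (𝓝[>] 0) (𝓝 z) := by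
    have := hΨcont.tendsto.comp hpath
    rwa [hΨ0] at this
  have hvert : fderiv ℝ G z (0, 1) = 0 :=
    fderiv_vertical_eq_zero hdiff hgrad hV hyV hG
      (fun q hq h1 h2 => ((hsurf q hq).1 ⟨h1, h2⟩).1) (hpathz.frequently hpathext.frequently)
  refine ⟨?_, ?_⟩
  · refine mem_closure_of_tendsto ((continuous_fst.tendsto z).comp hpathz) ?_
    filter_upwards [hpathext] with s hs using hs.1
  -- the derivative of the height in the direction normal to the boundary does not vanish
  have hLw : ∀ w : K, L ((0, 0), w) = 0 := by
    have hi : HasFDerivAt (fun w : K => (((0, 0), w) : (ℝ × ℝ) × K))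
        (ContinuousLinearMap.inr ℝ (ℝ × ℝ) K) 0 := (ContinuousLinearMap.inr ℝ (ℝ × ℝ) K).hasFDerivAt
    have h1 : HasFDerivAt (fun w : K => κ ((0, 0), w)) (L.comp (ContinuousLinearMap.inr ℝ _ _)) 0 :=
      HasFDerivAt.comp (0 : K) (g := κ) (f := fun w : K => (((0, 0), w) : (ℝ × ℝ) × K))
        hκd.hasFDerivAt hi
    have h2 : (fun w : K => κ ((0, 0), w)) =ᶠ[𝓝 0] fun _ => 0 := by
      filter_upwards [Metric.ball_mem_nhds (0 : K) hδ] with w hw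
      exact (hbd w (mem_ball_zero_iff.1 hw)).2
    have h3 := h1.unique ((hasFDerivAt_const (0 : ℝ) (0 : K)).congr_of_eventuallyEq h2)
    intro w
    exact DFunLike.congr_fun h3 w
  set b := L ((0, 1), 0) with hb
  have hLs : ∀ (s : ℝ) (w : K), L ((0, s), w) = b * s := by
    intro s w
    have : (((0, s), w) : (ℝ × ℝ) × K) = s • ((0, 1), 0) + ((0, 0), w) := by simp
    rw [this, map_add, map_smul, hLw, ← hb, smul_eq_mul, add_zero, mul_comm]
  have hb0 : b ≠ 0 := by
    intro h
    have h1 : L (A (0, 1)) = 1 := by simp [hL]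
    have h2 : A (0, 1) = ((0, fderiv ℝ B z (0, 1)), (A (0, 1)).2) := by
      refine Prod.ext ?_ rfl
      rw [hA1, ContinuousLinearMap.prod_apply, hvert]
    rw [h2, hLs, h, zero_mul] at h1
    exact zero_ne_one h1
  have hb2 : 0 < |b| / 2 := half_pos (abs_pos.2 hb0)
  obtain ⟨η, hη, hηN⟩ : ∃ η > 0, ∀ p ∈ Metric.ball (0 : (ℝ × ℝ) × K) η,
      ∀ p' ∈ Metric.ball (0 : (ℝ × ℝ) × K) η, |κ p - κ p' - L (p - p')| ≤ |b| / 2 * ‖p - p'‖ := by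
    have h1 := hκd.isLittleO.bound hb2
    rw [nhds_prod_eq, eventually_prod_self_iff'] at h1
    obtain ⟨t, ht, h2⟩ := h1
    obtain ⟨η, hη, hηt⟩ := Metric.mem_nhds_iff.1 ht
    exact ⟨η, hη, fun p hp p' hp' => h2 p (hηt hp) p' (hηt hp')⟩
  have hheight : ∀ p ∈ Metric.ball (0 : (ℝ × ℝ) × K) (min δ η), p.1.1 = 0 → 0 < p.1.2 →
      |κ p - b * p.1.2| ≤ |b| / 2 * p.1.2 := by
    rintro ⟨⟨c, s⟩, w⟩ hp (rfl : c = 0) (hs : 0 < s)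
    have hp' : ‖(((0, s), w) : (ℝ × ℝ) × K)‖ < min δ η := mem_ball_zero_iff.1 hp
    have hw : ‖w‖ < min δ η := (le_max_right _ _).trans_lt (by rwa [Prod.norm_def] at hp')
    have h1 := hηN ((0, s), w) (mem_ball_zero_iff.2 (hp'.trans_le (min_le_right _ _)))
      ((0, 0), w) (by
        rw [mem_ball_zero_iff, Prod.norm_def]
        exact max_lt (by simpa using hη) (hw.trans_le (min_le_right _ _)))
    have h2 : (((0, s), w) : (ℝ × ℝ) × K) - ((0, 0), w) = ((0, s), 0) := by simp
    have h3 : ‖(((0, s), 0) : (ℝ × ℝ) × K)‖ = s := by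
      simp [Prod.norm_def, abs_of_pos hs, hs.le]
    rw [h2, hLs, h3, (hbd w (hw.trans_le (min_le_left _ _))).2, sub_zero] at h1
    exact h1
  -- back to the original coordinates
  have hgraph : Tendsto (fun x => (x, f x)) (𝓝[Ωᶜ] y) (𝓝 z) :=
    (tendsto_id.mono_right nhdsWithin_le_nhds).prodMk_nhds (hcont y hyΩ)
  have hΦcont : ContinuousAt Φ z := Φ.continuousAt hzs
  have hnear : ∀ᶠ x in 𝓝[Ωᶜ] y, (x, f x) ∈ Φ.source ∧ (x, f x) ∈ V ∧
      Φ (x, f x) ∈ Metric.ball (0 : (ℝ × ℝ) × K) (min δ η) := by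
    have h1 : ∀ᶠ q in 𝓝 z, Φ q ∈ Metric.ball (0 : (ℝ × ℝ) × K) (min δ η) :=
      hΦcont.preimage_mem_nhds (by rw [hΦz0]; exact Metric.ball_mem_nhds 0 (lt_min hδ hη))
    have h2 : ∀ᶠ q in 𝓝 z, q ∈ Φ.source := Φ.open_source.mem_nhds hzs
    have h3 : ∀ᶠ q in 𝓝 z, q ∈ V := hV.mem_nhds hyV
    exact hgraph.eventually (h2.and (h3.and h1))
  rw [eventually_nhdsWithin_iff] at hnear
  obtain ⟨ε, hε, hεN⟩ := Metric.mem_nhds_iff.1 hnear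
  have hkey : ∀ x ∈ Metric.ball y ε \ closure Ω,
      ∃ s : ℝ, 0 < s ∧ |f x - f y - b * s| ≤ |b| / 2 * s := by
    rintro x ⟨hx, hxΩ⟩
    have hxn : x ∉ Ω := fun h => hxΩ (subset_closure h)
    obtain ⟨h1, h2, h3⟩ := hεN hx hxn
    obtain ⟨h4, h5⟩ := (hsurf (x, f x) h2).1 ⟨hxn, rfl⟩
    have h6 : B (x, f x) ≠ 0 := fun h => by
      obtain ⟨h7, -⟩ := (hbdry (x, f x) h2).2 ⟨h4, h⟩
      exact hxΩ (frontier_subset_closure h7)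
    have h7 := hΦ1 (x, f x)
    have h8 : κ (Φ (x, f x)) = f x - f y := by simp only [hκ, Φ.left_inv h1]
    have h9 := hheight _ h3 (by rw [h7]; exact h4)
      (by rw [h7]; exact lt_of_le_of_ne h5 (Ne.symm h6))
    rw [h7, h8] at h9
    exact ⟨B (x, f x), lt_of_le_of_ne h5 (Ne.symm h6), h9⟩
  refine ⟨ε, hε, ?_, ?_⟩
  · rintro x ⟨hx, hxf⟩
    have hxn : x ∉ Ω := fun h => by
      rw [hΩ.frontier_eq] at hxf; exact hxf.2 h
    obtain ⟨h1, h2, h3⟩ := hεN hx hxn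
    obtain ⟨h4, h5⟩ := (hbdry (x, f x) h2).1 ⟨hxf, rfl⟩
    have h6 : Φ (x, f x) = ((0, 0), (Φ (x, f x)).2) := by
      refine Prod.ext ?_ rfl
      rw [hΦ1, h4, h5]
    have h7 : ‖(Φ (x, f x)).2‖ < δ :=
      (norm_snd_le _).trans_lt ((mem_ball_zero_iff.1 h3).trans_le (min_le_left _ _))
    have h8 := (hbd _ h7).1
    rwa [← h6, Φ.left_inv h1] at h8
  · rcases lt_or_gt_of_ne hb0 with hneg | hpos
    · left
      intro x hx
      obtain ⟨s, hs, h1⟩ := hkey x hx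
      rw [abs_of_neg hneg] at h1
      have := (abs_le.1 h1).2
      nlinarith [mul_neg_of_neg_of_pos hneg hs]
    · right
      intro x hx
      obtain ⟨s, hs, h1⟩ := hkey x hx
      rw [abs_of_pos hpos] at h1
      have := (abs_le.1 h1).1
      nlinarith [mul_pos hpos hs]

section Comparison

/-! ### Topology of the complement of the graph domain -/

/-- A form of unicoherence: in a simply connected space, a closed connected set `E` and a connected
set `C` that meets `E` only in two separated closed pieces `D` and `U` containing the frontier of
`E` cannot meet both pieces. Otherwise the map to the circle that winds once from `D` to `U`
through `E` and is constant off `E` would lift to the line. -/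
lemma unicoherence {X : Type*} [TopologicalSpace X] [SimplyConnectedSpace X]
    [LocallyPathConnectedSpace X] [NormalSpace X] {E C D U : Set X} (hE : IsPreconnected E)
    (hC : IsPreconnected C) (hD : IsClosed D) (hU : IsClosed U)
    (hDU : Disjoint D U) (hfr : frontier E ⊆ D ∪ U) (hEC : C ∩ E ⊆ D ∪ U) {d u : X}
    (hd : d ∈ E ∩ C ∩ D) (hu : u ∈ E ∩ C ∩ U) : False := by
  classical
  obtain ⟨lam, hlD, hlU, -⟩ := exists_continuous_zero_one_of_isClosed hD hU hDU
  have hone : ((1 : ℝ) : AddCircle (1 : ℝ)) = 0 := AddCircle.coe_period 1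
  have hzero : ∀ x ∈ D ∪ U, ((lam x : ℝ) : AddCircle (1 : ℝ)) = 0 := by
    rintro x (hx | hx)
    · rw [hlD hx]; exact AddCircle.coe_zero 1
    · rw [hlU hx]; exact hone
  let g : C(X, AddCircle (1 : ℝ)) :=
    ⟨fun x => if x ∈ E then ((lam x : ℝ) : AddCircle (1 : ℝ)) else 0,
      continuous_if (fun x hx => hzero x (hfr hx))
        ((AddCircle.continuous_mk' 1).comp lam.continuous).continuousOn continuousOn_const⟩
  have hgE : ∀ x ∈ E, g x = ((lam x : ℝ) : AddCircle (1 : ℝ)) := fun x hx => if_pos hx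
  have hgC : ∀ x ∈ C, g x = 0 := by
    intro x hx
    by_cases hxE : x ∈ E
    · rw [hgE x hxE, hzero x (hEC ⟨hx, hxE⟩)]
    · exact if_neg hxE
  obtain ⟨F, ⟨-, hF⟩, -⟩ := (AddCircle.isCoveringMap_coe (1 : ℝ)).existsUnique_continuousMap_lifts
    g d 0 (by rw [hgC d hd.1.2]; exact AddCircle.coe_zero 1)
  have hFx : ∀ x, ((F x : ℝ) : AddCircle (1 : ℝ)) = g x := fun x => congrFun hF x
  have hdisc : IsDiscrete (AddSubgroup.zmultiples (1 : ℝ) : Set ℝ) :=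
    ⟨inferInstanceAs (DiscreteTopology (AddSubgroup.zmultiples (1 : ℝ)))⟩
  have h1 : F d = F u := by
    refine hC.constant_of_mapsTo hdisc (T := (AddSubgroup.zmultiples (1 : ℝ) : Set ℝ))
      F.continuous.continuousOn (fun x hx => ?_) hd.1.2 hu.1.2
    exact (QuotientAddGroup.eq_zero_iff _).1 ((hFx x).trans (hgC x hx))
  have h2 : F d - lam d = F u - lam u := by
    refine hE.constant_of_mapsTo hdisc (f := fun x => F x - lam x)
      (T := (AddSubgroup.zmultiples (1 : ℝ) : Set ℝ))
      (F.continuous.sub lam.continuous).continuousOn (fun x hx => ?_) hd.1.1 hu.1.1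
    refine (QuotientAddGroup.eq_zero_iff _).1 ?_
    have : ((F x - lam x : ℝ) : AddCircle (1 : ℝ)) = 0 := by
      rw [AddCircle.coe_sub, hFx, hgE x hx, sub_self]
    exact this
  rw [h1, hlD hd.2, hlU hu.2] at h2
  simp only [Pi.zero_apply, Pi.one_apply] at h2
  linarith

variable {n : ℕ} {Ω : Set (EuclideanSpace ℝ (Fin n))} {f fbar : EuclideanSpace ℝ (Fin n) → ℝ}

/-- Leaving an open set along a segment, one stays in one component of its closure up to the first
boundary point. -/
lemma exists_mem_segment_frontier (hΩ : IsOpen Ω) {z y : EuclideanSpace ℝ (Fin n)} (hz : z ∈ Ω)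
    (hy : y ∉ Ω) : ∃ w ∈ segment ℝ z y, w ∈ frontier Ω ∧
      w ∈ connectedComponentIn (closure Ω) z := by
  set γ : ℝ → EuclideanSpace ℝ (Fin n) := fun t => AffineMap.lineMap z y t with hγ
  have hγc : Continuous γ := AffineMap.lineMap_continuous
  have hγ0 : γ 0 = z := AffineMap.lineMap_apply_zero z y
  have hγ1 : γ 1 = y := AffineMap.lineMap_apply_one z y
  have hcomp : IsCompact (Set.Icc (0 : ℝ) 1 ∩ γ ⁻¹' Ωᶜ) :=
    isCompact_Icc.inter_right (hΩ.isClosed_compl.preimage hγc)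
  obtain ⟨t₀, ⟨⟨ht0, ht1⟩, htΩ⟩, hleast⟩ := hcomp.exists_isLeast
    ⟨1, ⟨zero_le_one, le_rfl⟩, by simpa [hγ1] using hy⟩
  have htpos : 0 < t₀ := by
    refine lt_of_le_of_ne ht0 fun h => htΩ ?_
    rw [← h, hγ0]; exact hz
  have hin : ∀ t ∈ Set.Ico 0 t₀, γ t ∈ Ω := by
    rintro t ⟨h1, h2⟩
    by_contra h3
    exact absurd (hleast ⟨⟨h1, h2.le.trans ht1⟩, h3⟩) (not_le.2 h2)
  have hcl : Set.MapsTo γ (Set.Icc 0 t₀) (closure Ω) := by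
    have : Set.MapsTo γ (closure (Set.Ico 0 t₀)) (closure Ω) :=
      Set.MapsTo.closure (fun t ht => hin t ht) hγc
    rwa [closure_Ico htpos.ne] at this
  have hsub := ((isPreconnected_Icc (a := (0 : ℝ)) (b := t₀)).image γ
    hγc.continuousOn).subset_connectedComponentIn (x := z)
    ⟨0, ⟨le_rfl, ht0⟩, hγ0⟩ hcl.image_subset
  refine ⟨γ t₀, ?_, ?_, hsub ⟨t₀, ⟨ht0, le_rfl⟩, rfl⟩⟩
  · rw [segment_eq_image_lineMap]
    exact ⟨t₀, ⟨ht0, ht1⟩, rfl⟩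
  · rw [hΩ.frontier_eq]
    exact ⟨hcl ⟨ht0, le_rfl⟩, htΩ⟩

lemma IsConstantExtension.eventually_eq_of_mem (hext : IsConstantExtension Ω f fbar)
    (hΩ : IsOpen Ω) {x : EuclideanSpace ℝ (Fin n)} (hx : x ∈ Ω) :
    ∀ᶠ y in 𝓝 x, fbar y = fbar x := by
  obtain ⟨ε, hε, hball⟩ := Metric.isOpen_iff.1 hΩ x hx
  filter_upwards [Metric.ball_mem_nhds x hε] with y hy
  refine hext.2 x (subset_closure hx) y ?_
  exact (convex_ball x ε).isPreconnected.subset_connectedComponentIn (Metric.mem_ball_self hε)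
    (hball.trans subset_closure) hy

lemma IsConstantExtension.continuous (hext : IsConstantExtension Ω f fbar) (hΩ : IsOpen Ω)
    (hcont : ContinuousOn f Ωᶜ) : Continuous fbar := by
  rw [continuous_iff_continuousAt]
  intro x
  by_cases hx : x ∈ Ω
  · exact continuousAt_const.congr ((hext.eventually_eq_of_mem hΩ hx).mono fun y hy => hy.symm)
  · rw [Metric.continuousAt_iff]
    intro η hη
    obtain ⟨δ, hδ, h⟩ := Metric.continuousWithinAt_iff.1 (hcont x hx) η hη
    refine ⟨δ, hδ, fun {z} hz => ?_⟩
    rw [hext.1 x hx]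
    by_cases hzΩ : z ∈ Ω
    · obtain ⟨w, hw1, hw2, hw3⟩ := exists_mem_segment_frontier hΩ hzΩ hx
      rw [hΩ.frontier_eq] at hw2
      rw [← hext.2 z (subset_closure hzΩ) w hw3, hext.1 w hw2.2]
      exact h hw2.2 ((convex_ball x δ).segment_subset hz (Metric.mem_ball_self hδ) hw1)
    · rw [hext.1 z hzΩ]
      exact h hzΩ hz

/-- Where the boundary near `p` lies in one component, so does the closure of the domain. -/
lemma ball_inter_closure_subset_component (hΩ : IsOpen Ω) {p : EuclideanSpace ℝ (Fin n)} {ε : ℝ}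
    (hε : 0 < ε) (hp : p ∈ frontier Ω)
    (h : Metric.ball p ε ∩ frontier Ω ⊆ connectedComponentIn (frontier Ω) p) :
    Metric.ball p ε ∩ closure Ω ⊆ connectedComponentIn (closure Ω) p := by
  have hsub : Metric.ball p ε ∩ frontier Ω ⊆ connectedComponentIn (closure Ω) p :=
    h.trans (connectedComponentIn_mono p frontier_subset_closure)
  rintro z ⟨hz, hzc⟩
  by_cases hzΩ : z ∈ Ω
  · have hpΩ : p ∉ Ω := by rw [hΩ.frontier_eq] at hp; exact hp.2
    obtain ⟨w, hw1, hw2, hw3⟩ := exists_mem_segment_frontier hΩ hzΩ hpΩ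
    have hw4 := hsub ⟨(convex_ball p ε).segment_subset hz (Metric.mem_ball_self hε) hw1, hw2⟩
    rw [connectedComponentIn_eq hw4, ← connectedComponentIn_eq hw3]
    exact mem_connectedComponentIn hzc
  · exact hsub ⟨hz, by rw [hΩ.frontier_eq]; exact ⟨hzc, hzΩ⟩⟩

/-! ### Downward boundary components do not exist -/

/-- The graph of `f` leaves the boundary point `y` strictly downward. -/
def LeavesDownward (Ω : Set (EuclideanSpace ℝ (Fin n))) (f : EuclideanSpace ℝ (Fin n) → ℝ)
    (y : EuclideanSpace ℝ (Fin n)) : Prop :=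
  ∃ ε > 0, ∀ x ∈ Metric.ball y ε \ closure Ω, f x < f y

lemma EntireOrMinimalBoundary.contDiffAt {k : ℕ} (hf : EntireOrMinimalBoundary k Ω f)
    {x : EuclideanSpace ℝ (Fin n)} (hx : x ∈ (closure Ω)ᶜ) : ContDiffAt ℝ k f x :=
  hf.contDiffOn.contDiffAt (isClosed_closure.isOpen_compl.mem_nhds hx)

lemma EntireOrMinimalBoundary.local_structure {k : ℕ} (hf : EntireOrMinimalBoundary (k + 1) Ω f)
    {y : EuclideanSpace ℝ (Fin n)} (hy : y ∈ frontier Ω) :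
    y ∈ closure (closure Ω)ᶜ ∧ ∃ ε > 0,
      Metric.ball y ε ∩ frontier Ω ⊆ connectedComponentIn (frontier Ω) y ∧
      ((∀ x ∈ Metric.ball y ε \ closure Ω, f x < f y) ∨
        ∀ x ∈ Metric.ball y ε \ closure Ω, f y < f x) :=
  boundary_local_structure hf.isOpen (hf.contDiffOn.of_le (by norm_cast; omega)) hf.continuousOn
    hf.const_on_boundary (hf.gradient_blowup y hy) hf.hypersurface hy

/-- Leaving downward is a locally constant property of boundary points. -/
lemma EntireOrMinimalBoundary.leavesDownward_locally_const {k : ℕ}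
    (hf : EntireOrMinimalBoundary (k + 1) Ω f)
    {y : EuclideanSpace ℝ (Fin n)} (hy : y ∈ frontier Ω) :
    ∃ ε > 0, ∀ y' ∈ Metric.ball y ε ∩ frontier Ω,
      (LeavesDownward Ω f y' ↔ LeavesDownward Ω f y) := by
  obtain ⟨-, ε, hε, hcomp, hdich⟩ := hf.local_structure hy
  refine ⟨ε, hε, fun y' hy' => ?_⟩
  have hval : f y' = f y := hf.const_on_boundary y hy y' (hcomp hy')
  rcases hdich with hdown | hup
  · refine iff_of_true ?_ ⟨ε, hε, hdown⟩
    obtain ⟨δ, hδ, hsub⟩ := Metric.isOpen_iff.1 Metric.isOpen_ball y' hy'.1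
    refine ⟨δ, hδ, fun x hx => ?_⟩
    rw [hval]
    exact hdown x ⟨hsub hx.1, hx.2⟩
  · have key : ∀ z ∈ Metric.ball y ε ∩ frontier Ω, f z = f y → ¬ LeavesDownward Ω f z := by
      rintro z ⟨hz, hzf⟩ hzval ⟨δ, hδ, hd⟩
      obtain ⟨x, ⟨hx1, hx2⟩, hx3⟩ := mem_closure_iff_nhds.1 (hf.local_structure hzf).1 _
        (inter_mem (Metric.ball_mem_nhds z hδ) (Metric.isOpen_ball.mem_nhds hz))
      have h1 := hd x ⟨hx1, hx3⟩
      have h2 := hup x ⟨hx2, hx3⟩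
      linarith
    exact iff_of_false (key y' hy' hval) (key y ⟨Metric.mem_ball_self hε, hy⟩ rfl)

lemma isClosed_component (Ω : Set (EuclideanSpace ℝ (Fin n))) (x : EuclideanSpace ℝ (Fin n)) :
    IsClosed (connectedComponentIn (closure Ω) x) := by
  by_cases hx : x ∈ closure Ω
  · refine isClosed_of_closure_subset ?_
    refine isPreconnected_connectedComponentIn.closure.subset_connectedComponentIn
      (subset_closure (mem_connectedComponentIn hx)) ?_
    exact closure_minimal (connectedComponentIn_subset _ _) isClosed_closure
  · rw [connectedComponentIn_eq_empty hx]
    exact isClosed_empty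

lemma component_mem_nhds (hΩ : IsOpen Ω) {x y : EuclideanSpace ℝ (Fin n)} (hy : y ∈ Ω)
    (hyE : y ∈ connectedComponentIn (closure Ω) x) : connectedComponentIn (closure Ω) x ∈ 𝓝 y := by
  obtain ⟨ε, hε, hball⟩ := Metric.isOpen_iff.1 hΩ y hy
  filter_upwards [Metric.ball_mem_nhds y hε] with z hz
  rw [connectedComponentIn_eq hyE]
  exact (convex_ball y ε).isPreconnected.subset_connectedComponentIn (Metric.mem_ball_self hε)
    (hball.trans subset_closure) hz

/-- All boundary points on one component of the closure of `Ω` leave in the same direction. -/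
lemma EntireOrMinimalBoundary.leavesDownward_of_component {k : ℕ}
    (hf : EntireOrMinimalBoundary (k + 1) Ω f) {x p : EuclideanSpace ℝ (Fin n)}
    (hx : x ∈ frontier Ω) (hdown : LeavesDownward Ω f x) (hp : p ∈ frontier Ω)
    (hpE : p ∈ connectedComponentIn (closure Ω) x) : LeavesDownward Ω f p := by
  by_contra hnot
  set D := {y | y ∈ frontier Ω ∧ LeavesDownward Ω f y} with hD
  set U := {y | y ∈ frontier Ω ∧ ¬ LeavesDownward Ω f y} with hU
  have hfr : frontier Ω = D ∪ U := by
    ext y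
    simp only [hD, hU, Set.mem_union, Set.mem_ofPred_eq]
    tauto
  have hout : ∀ y ∈ frontier Ω, y ∈ Ωᶜ := fun y hy => by
    rw [hf.isOpen.frontier_eq] at hy; exact hy.2
  have hDc : IsClosed D := by
    refine isClosed_of_closure_subset fun y hy => ?_
    have hyf : y ∈ frontier Ω :=
      closure_minimal (fun z hz => hz.1) isClosed_frontier hy
    obtain ⟨ε, hε, h⟩ := hf.leavesDownward_locally_const hyf
    obtain ⟨z, hz1, hz2⟩ := mem_closure_iff_nhds.1 hy _ (Metric.ball_mem_nhds y hε)
    exact ⟨hyf, (h z ⟨hz1, hz2.1⟩).1 hz2.2⟩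
  have hUc : IsClosed U := by
    refine isClosed_of_closure_subset fun y hy => ?_
    have hyf : y ∈ frontier Ω :=
      closure_minimal (fun z hz => hz.1) isClosed_frontier hy
    obtain ⟨ε, hε, h⟩ := hf.leavesDownward_locally_const hyf
    obtain ⟨z, hz1, hz2⟩ := mem_closure_iff_nhds.1 hy _ (Metric.ball_mem_nhds y hε)
    exact ⟨hyf, fun h' => hz2.2 ((h z ⟨hz1, hz2.1⟩).2 h')⟩
  have hxc : x ∈ closure Ω := frontier_subset_closure hx
  refine unicoherence (E := connectedComponentIn (closure Ω) x) (C := Ωᶜ)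
    isPreconnected_connectedComponentIn hf.isConnected_compl.isPreconnected hDc hUc
    (Set.disjoint_left.2 fun y h1 h2 => h2.2 h1.2) ?_ ?_
    ⟨⟨mem_connectedComponentIn hxc, hout x hx⟩, hx, hdown⟩ ⟨⟨hpE, hout p hp⟩, hp, hnot⟩
  · intro y hy
    rw [← hfr, hf.isOpen.frontier_eq]
    have hyE : y ∈ connectedComponentIn (closure Ω) x := (isClosed_component Ω x).frontier_subset hy
    exact ⟨connectedComponentIn_subset _ _ hyE, fun h =>
      hy.2 (mem_interior_iff_mem_nhds.2 (component_mem_nhds hf.isOpen h hyE))⟩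
  · rintro y ⟨hy1, hy2⟩
    rw [← hfr, hf.isOpen.frontier_eq]
    exact ⟨connectedComponentIn_subset _ _ hy2, hy1⟩

/-- The graph never leaves the boundary downward: otherwise, slightly below the boundary value, a
superlevel set of `f` around a component of the closure of `Ω` would touch a ball from inside. -/
lemma EntireOrMinimalBoundary.not_leavesDownward {k : ℕ} (hn : 2 ≤ n)
    (hf : EntireOrMinimalBoundary (k + 2) Ω f) (hext : IsConstantExtension Ω f fbar)
    (hcone : ∀ x ∈ (closure Ω)ᶜ,
      GardingCone (sqrtInv (gradVec f x) * hess f x * sqrtInv (gradVec f x)))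
    {x₀ : EuclideanSpace ℝ (Fin n)} (hx₀ : x₀ ∈ frontier Ω) (hne : x₀ ≠ 0) :
    ¬ LeavesDownward Ω f x₀ := by
  intro hdown
  have hΩ := hf.isOpen
  have hfc : Continuous fbar := hext.continuous hΩ hf.continuousOn
  set E := connectedComponentIn (closure Ω) x₀ with hE
  have hx₀E : x₀ ∈ E := mem_connectedComponentIn (frontier_subset_closure hx₀)
  have hEsub : E ⊆ closure Ω := connectedComponentIn_subset _ _
  have hEcomp : IsCompact E :=
    Metric.isCompact_of_isClosed_isBounded (isClosed_component Ω x₀) (hf.isBounded.closure.subset hEsub)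
  -- the point of `E` farthest from the origin
  obtain ⟨p, hpE, hpmax⟩ := hEcomp.exists_isMaxOn ⟨x₀, hx₀E⟩ continuous_norm.continuousOn
  have hpmax' : ∀ x ∈ E, ‖x‖ ≤ ‖p‖ := fun x hx => hpmax hx
  have hρ : 0 < ‖p‖ := (norm_pos_iff.2 hne).trans_le (hpmax' x₀ hx₀E)
  have hray : Tendsto (fun t : ℝ => (1 + t) • p) (𝓝[>] 0) (𝓝 p) := by
    have : Continuous (fun t : ℝ => (1 + t) • p) := by fun_prop
    have := this.tendsto 0
    simp only [add_zero, one_smul] at this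
    exact this.mono_left nhdsWithin_le_nhds
  have hpf : p ∈ frontier Ω := by
    rw [hΩ.frontier_eq]
    refine ⟨hEsub hpE, fun hpΩ => ?_⟩
    obtain ⟨t, ht, ht0⟩ := ((hray.eventually (component_mem_nhds hΩ hpΩ hpE)).and
      self_mem_nhdsWithin).exists
    have ht0' : 0 < t := ht0
    have h1 := hpmax' _ ht
    rw [norm_smul, Real.norm_eq_abs, abs_of_pos (by linarith)] at h1
    nlinarith
  have hpΩ : p ∉ Ω := by rw [hΩ.frontier_eq] at hpf; exact hpf.2
  obtain ⟨ε₁, hε₁, hd⟩ := hf.leavesDownward_of_component hx₀ hdown hpf hpE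
  obtain ⟨-, ε₂, hε₂, hcomp, -⟩ := hf.local_structure hpf
  obtain ⟨ε₃, hε₃, hgr⟩ : ∃ ε₃ > 0, ∀ x ∈ Metric.ball p ε₃ \ closure Ω, gradient f x ≠ 0 := by
    have h1 := (hf.gradient_blowup p hpf).eventually (eventually_gt_atTop 0)
    rw [eventually_nhdsWithin_iff] at h1
    obtain ⟨ε, hε, h2⟩ := Metric.mem_nhds_iff.1 h1
    exact ⟨ε, hε, fun x hx => norm_pos_iff.1 (h2 hx.1 hx.2)⟩
  obtain ⟨R, hR, hR1, hR2, hR3⟩ : ∃ R > 0, R < ε₁ ∧ R < ε₂ ∧ R < ε₃ := by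
    refine ⟨min ε₁ (min ε₂ ε₃) / 2, by positivity, ?_, ?_, ?_⟩ <;>
    · have h0 : 0 < min ε₁ (min ε₂ ε₃) := by positivity
      have h1 := min_le_left ε₁ (min ε₂ ε₃)
      have h2 := (min_le_right ε₁ (min ε₂ ε₃)).trans (min_le_left ε₂ ε₃)
      have h3 := (min_le_right ε₁ (min ε₂ ε₃)).trans (min_le_right ε₂ ε₃)
      linarith
  have hin : Metric.closedBall p R ∩ closure Ω ⊆ E := by
    rintro x ⟨hx, hxc⟩
    have h1 := ball_inter_closure_subset_component hΩ hε₂ hpf hcomp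
      ⟨Metric.closedBall_subset_ball hR2 hx, hxc⟩
    rwa [hE, connectedComponentIn_eq hpE]
  have hfbarp : fbar p = f p := hext.1 p hpΩ
  have hfbar_out : ∀ x ∈ Metric.closedBall p R, x ∉ closure Ω → fbar x < f p := by
    intro x hx hxc
    rw [hext.1 x fun h => hxc (subset_closure h)]
    exact hd x ⟨Metric.closedBall_subset_ball hR1 hx, hxc⟩
  -- distances are measured from `-p`, so that `p` is the only farthest point of `E`
  have hψE : ∀ x ∈ E, ‖x - -p‖ ≤ 2 * ‖p‖ := by
    intro x hx
    rw [sub_neg_eq_add]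
    linarith [norm_add_le x p, hpmax' x hx]
  have hψeq : ∀ x ∈ E, 2 * ‖p‖ ≤ ‖x - -p‖ → x = p := by
    intro x hx h1
    rw [sub_neg_eq_add] at h1
    have h2 := parallelogram_law_with_norm ℝ x p
    have h3 := hpmax' x hx
    have h4 : ‖x - p‖ * ‖x - p‖ ≤ 0 := by nlinarith [norm_nonneg x, norm_nonneg (x + p)]
    have h5 : ‖x - p‖ = 0 := by nlinarith [norm_nonneg (x - p)]
    exact sub_eq_zero.1 (norm_eq_zero.1 h5)
  have hTc : IsCompact (Metric.sphere p R ∩ {x | 2 * ‖p‖ ≤ ‖x - -p‖}) :=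
    (isCompact_sphere p R).inter_right (isClosed_le continuous_const (by fun_prop))
  have hTlt : ∀ x ∈ Metric.sphere p R ∩ {x | 2 * ‖p‖ ≤ ‖x - -p‖}, fbar x < f p := by
    rintro x ⟨hx1, hx2⟩
    refine hfbar_out x (Metric.sphere_subset_closedBall hx1) fun hxc => ?_
    have := hψeq x (hin ⟨Metric.sphere_subset_closedBall hx1, hxc⟩) hx2
    rw [this, mem_sphere_iff_norm, sub_self, norm_zero] at hx1
    exact hR.ne hx1
  obtain ⟨h, hhc, hhT⟩ : ∃ h < f p, ∀ x ∈ Metric.sphere p R ∩ {x | 2 * ‖p‖ ≤ ‖x - -p‖},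
      fbar x < h := by
    rcases (Metric.sphere p R ∩ {x | 2 * ‖p‖ ≤ ‖x - -p‖}).eq_empty_or_nonempty with hemp | hnon
    · exact ⟨f p - 1, by linarith, fun x hx => by rw [hemp] at hx; exact hx.elim⟩
    · obtain ⟨a, ha, hamax⟩ := hTc.exists_isMaxOn hnon hfc.continuousOn
      have h1 := hTlt a ha
      refine ⟨(fbar a + f p) / 2, by linarith, fun x hx => ?_⟩
      have h2 : fbar x ≤ fbar a := hamax hx
      linarith
  -- the farthest point of the superlevel set at height `h`
  have hScomp : IsCompact (Metric.closedBall p R ∩ {x | h ≤ fbar x}) :=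
    (isCompact_closedBall p R).inter_right (isClosed_le continuous_const hfc)
  obtain ⟨xh, ⟨hxhB, hxhh⟩, hxhmax⟩ := hScomp.exists_isMaxOn
    ⟨p, Metric.mem_closedBall_self hR.le, by rw [Set.mem_ofPred_eq, hfbarp]; exact hhc.le⟩
    (f := fun x => ‖x - -p‖) (by fun_prop)
  have hxhmax' : ∀ x ∈ Metric.closedBall p R, h ≤ fbar x → ‖x - -p‖ ≤ ‖xh - -p‖ :=
    fun x h1 h2 => hxhmax ⟨h1, h2⟩
  have hxhψ : 2 * ‖p‖ < ‖xh - -p‖ := by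
    have h1 : ∀ᶠ x in 𝓝 p, h < fbar x :=
      hfc.continuousAt.eventually (lt_mem_nhds (by rw [hfbarp]; exact hhc))
    obtain ⟨t, ⟨ht1, ht2⟩, ht0⟩ := (((hray.eventually h1).and
      (hray.eventually (Metric.closedBall_mem_nhds p hR))).and self_mem_nhdsWithin).exists
    have ht0' : 0 < t := ht0
    have h2 := hxhmax' _ ht2 ht1.le
    have h3 : (1 + t) • p - -p = (2 + t) • p := by module
    rw [h3, norm_smul, Real.norm_eq_abs, abs_of_pos (by linarith)] at h2
    nlinarith
  have hxhball : xh ∈ Metric.ball p R := by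
    rcases lt_or_eq_of_le (Metric.mem_closedBall.1 hxhB) with h1 | h1
    · exact h1
    · exact absurd (hhT xh ⟨h1, hxhψ.le⟩) (not_lt.2 hxhh)
  have hxhc : xh ∉ closure Ω := fun h1 =>
    absurd (hψE xh (hin ⟨hxhB, h1⟩)) (not_le.2 hxhψ)
  have hlevel : ∀ y ∈ Metric.ball p R, ‖xh - -p‖ ≤ ‖y - -p‖ → fbar y ≤ fbar xh := by
    intro y hy hψ
    refine le_trans ?_ hxhh
    have hpos : 0 < ‖y - -p‖ := by linarith
    have hγ : Tendsto (fun t : ℝ => y + t • (y - -p)) (𝓝[>] 0) (𝓝 y) := by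
      have : Continuous (fun t : ℝ => y + t • (y - -p)) := by fun_prop
      have := this.tendsto 0
      simp only [zero_smul, add_zero] at this
      exact this.mono_left nhdsWithin_le_nhds
    refine le_of_tendsto ((hfc.tendsto y).comp hγ) ?_
    filter_upwards [hγ.eventually (Metric.isOpen_ball.mem_nhds hy), self_mem_nhdsWithin]
      with t ht (ht0 : 0 < t)
    by_contra! hcon
    have h1 := hxhmax' _ (Metric.ball_subset_closedBall ht) hcon.le
    have h2 : y + t • (y - -p) - -p = (1 + t) • (y - -p) := by module
    rw [h2, norm_smul, Real.norm_eq_abs, abs_of_pos (by linarith)] at h1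
    nlinarith
  have hgrad0 : gradient f xh = 0 := by
    refine gradient_eq_zero_of_superlevel_inside_ball hn (q := -p)
      ((hf.contDiffAt hxhc).of_le (by norm_cast; omega)) (hcone xh hxhc) ?_ ?_
    · intro h1
      rw [h1, sub_self, norm_zero] at hxhψ
      linarith
    · filter_upwards [Metric.isOpen_ball.mem_nhds hxhball,
        isClosed_closure.isOpen_compl.mem_nhds hxhc] with y hy hyc hψ
      have h1 := hlevel y hy hψ
      rwa [hext.1 y fun h => hyc (subset_closure h),
        hext.1 xh fun h => hxhc (subset_closure h)] at h1
  exact hgr xh ⟨Metric.closedBall_subset_ball hR3 hxhB, hxhc⟩ hgrad0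

/-! ### Comparison with the Schwarzschild profile -/

/-- Comparison with a vertically scaled profile of larger mass. -/
lemma le_scaled_schwarzschild (hn : n = 3 ∨ n = 4) {m M l Λ r₁ h₁ : ℝ}
    (hf : EntireOrMinimalBoundary (n + 1) Ω f) (hm : 0 < m) (hM : 0 < M) (hl0 : 0 < l)
    (hl1 : l < 1) (hlM : m < l ^ 2 * M)
    (hcone : ∀ x ∈ (closure Ω)ᶜ,
      GardingCone (sqrtInv (gradVec f x) * hess f x * sqrtInv (gradVec f x)))
    (hS₃ : n = 3 → (fun x : EuclideanSpace ℝ (Fin n) => f x - (Λ + schwarzschild n m ‖x‖))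
      =o[Bornology.cobounded (EuclideanSpace ℝ (Fin n))] fun x => ‖x‖ ^ (1 / 2 : ℝ))
    (hS₄ : n = 4 → (fun x : EuclideanSpace ℝ (Fin n) => f x - (Λ + schwarzschild n m ‖x‖))
      =o[Bornology.cobounded (EuclideanSpace ℝ (Fin n))] fun x => Real.log ‖x‖)
    (hext : IsConstantExtension Ω f fbar) (hr0 : 0 < r₁) (hr₁ : 2 * M < r₁ ^ (n - 2))
    (hh₁ : Metric.ball (0 : EuclideanSpace ℝ (Fin n)) r₁ ⊆ sublevel fbar h₁)
    {x : EuclideanSpace ℝ (Fin n)} (hx : r₁ ≤ ‖x‖) :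
    fbar x - l * schwarzschild n M ‖x‖ ≤ h₁ - l * schwarzschild n M r₁ := by
  obtain ⟨k, hk⟩ : ∃ k, n + 1 = k + 2 := ⟨n - 1, by omega⟩
  have hf' : EntireOrMinimalBoundary (k + 2) Ω f := hk ▸ hf
  have hn2 : 2 ≤ n := by omega
  have hΩ := hf.isOpen
  have hfc : Continuous fbar := hext.continuous hΩ hf.continuousOn
  have hpow : ∀ r, r₁ ≤ r → 0 < r ∧ 2 * M < r ^ (n - 2) := fun r hr =>
    ⟨hr0.trans_le hr, hr₁.trans_le (pow_le_pow_left₀ hr0.le hr _)⟩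
  have hu : ∀ r, r₁ ≤ r → HasDerivAt (schwarzschild n M) (schwarzschildDeriv n M r) r := fun r hr =>
    hasDerivAt_schwarzschild hn hM (hpow r hr).1 (hpow r hr).2
  have hclosed : IsClosed {y : EuclideanSpace ℝ (Fin n) | r₁ ≤ ‖y‖} :=
    isClosed_le continuous_const continuous_norm
  have hcont : ContinuousOn (fun y => fbar y - l * schwarzschild n M ‖y‖)
      {y : EuclideanSpace ℝ (Fin n) | r₁ ≤ ‖y‖} := by
    intro y hy
    refine ContinuousAt.continuousWithinAt (hfc.continuousAt.sub (continuousAt_const.mul ?_))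
    exact ContinuousAt.comp (g := schwarzschild n M) (hu _ hy).continuousAt
      continuous_norm.continuousAt
  have hinf : Tendsto (fun y => fbar y - l * schwarzschild n M ‖y‖)
      (Bornology.cobounded (EuclideanSpace ℝ (Fin n))) atBot := by
    refine (tendsto_sub_scaled_schwarzschild hn hm hM hl0 hlM hS₃ hS₄).congr' ?_
    have : Ωᶜ ∈ Bornology.cobounded (EuclideanSpace ℝ (Fin n)) :=
      Bornology.isBounded_def.1 hf.isBounded
    filter_upwards [this] with y hy
    rw [hext.1 y hy]
  obtain ⟨x₀, hx₀, hmax⟩ := hcont.exists_isMaxOn' hclosed hx (by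
    rw [← Metric.cobounded_eq_cocompact]
    exact (hinf.eventually (eventually_le_atBot _)).filter_mono inf_le_left)
  have hx₀' : r₁ ≤ ‖x₀‖ := hx₀
  have hmax' : ∀ y, r₁ ≤ ‖y‖ → fbar y - l * schwarzschild n M ‖y‖ ≤
      fbar x₀ - l * schwarzschild n M ‖x₀‖ := fun y hy => hmax hy
  refine (hmax' x hx).trans ?_
  rcases eq_or_lt_of_le hx₀' with heq | hlt
  · -- the maximum is on the inner sphere
    have h1 : x₀ ∈ closure (Metric.ball (0 : EuclideanSpace ℝ (Fin n)) r₁) := by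
      rw [closure_ball _ hr0.ne', mem_closedBall_zero_iff, heq]
    have h2 : fbar x₀ ≤ h₁ :=
      closure_minimal (fun y hy => (hh₁ hy : fbar y < h₁).le)
        (isClosed_le hfc continuous_const) h1
    rw [← heq]
    linarith
  · exfalso
    have hx₀0 : x₀ ≠ 0 := norm_pos_iff.1 (hr0.trans hlt)
    have hnear : ∀ᶠ y in 𝓝 x₀, r₁ < ‖y‖ :=
      continuous_norm.continuousAt.eventually (lt_mem_nhds hlt)
    -- the profile increases, so `fbar` takes a smaller value somewhere near `x₀`
    have hinward : ¬ ∀ᶠ y in 𝓝 x₀, fbar x₀ ≤ fbar y := by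
      intro h1
      have hγ : Tendsto (fun t : ℝ => (1 - t) • x₀) (𝓝[>] 0) (𝓝 x₀) := by
        have : Continuous (fun t : ℝ => (1 - t) • x₀) := by fun_prop
        have := this.tendsto 0
        simp only [sub_zero, one_smul] at this
        exact this.mono_left nhdsWithin_le_nhds
      obtain ⟨t, ⟨ht1, ht2⟩, ht3, ht4⟩ := (((hγ.eventually h1).and (hγ.eventually hnear)).and
        (Ioo_mem_nhdsGT (zero_lt_one' ℝ))).exists
      have h2 : ‖(1 - t) • x₀‖ < ‖x₀‖ := by
        rw [norm_smul, Real.norm_eq_abs, abs_of_pos (by linarith)]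
        nlinarith [norm_pos_iff.2 hx₀0]
      have h3 := schwarzschild_strictMonoOn hn hM hr0 hr₁ (Set.mem_Ici.2 ht2.le)
        (Set.mem_Ici.2 hx₀') h2
      have h4 := hmax' _ ht2.le
      nlinarith [mul_lt_mul_of_pos_left h3 hl0]
    by_cases hc : x₀ ∈ closure Ω
    · by_cases hxΩ : x₀ ∈ Ω
      · exact hinward ((hext.eventually_eq_of_mem hΩ hxΩ).mono fun y hy => hy.ge)
      · have hxf : x₀ ∈ frontier Ω := by rw [hΩ.frontier_eq]; exact ⟨hc, hxΩ⟩
        obtain ⟨-, ε, hε, hcomp, hdown | hup⟩ := hf.local_structure hxf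
        · exact hf'.not_leavesDownward hn2 hext hcone hxf hx₀0 ⟨ε, hε, hdown⟩
        · refine hinward ?_
          filter_upwards [Metric.ball_mem_nhds x₀ hε] with y hy
          by_cases hyc : y ∈ closure Ω
          · exact (hext.2 x₀ hc y
              (ball_inter_closure_subset_component hΩ hε hxf hcomp ⟨hy, hyc⟩)).ge
          · rw [hext.1 x₀ hxΩ, hext.1 y fun h => hyc (subset_closure h)]
            exact (hup y ⟨hy, hyc⟩).le
    · have hloc : IsLocalMax (fun y => f y - l * schwarzschild n M ‖y‖) x₀ := by
        filter_upwards [hnear, isClosed_closure.isOpen_compl.mem_nhds hc] with y hy hyc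
        have h1 := hmax' y hy.le
        rwa [hext.1 y fun h => hyc (subset_closure h),
          hext.1 x₀ fun h => hc (subset_closure h)] at h1
      obtain ⟨hp1, hp2⟩ := hpow _ hx₀'
      have h1 := radial_curvature_nonneg_of_isLocalMax hn2
        (u := fun r => l * schwarzschild n M r) (u₁ := fun r => l * schwarzschildDeriv n M r)
        ((hf.contDiffAt hc).of_le (by norm_cast; omega)) (hcone x₀ hc) hx₀0
        ((lt_mem_nhds hlt).mono fun r (hr : r₁ < r) => (hu r hr.le).const_mul l)
        ((hasDerivAt_schwarzschildDeriv hn hM hp1 hp2).const_mul l)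
        (mul_pos hl0 (schwarzschildDeriv_pos hM hp2)) hloc
      exact absurd h1 (not_le.2 (scaled_schwarzschild_curvature_neg hn hM hp1 hp2 hl0 hl1))

end Comparison

end GraphPMT

theorem mainTheorem7 (n : ℕ) (hn : n = 3 ∨ n = 4)
    (Ω : Set (EuclideanSpace ℝ (Fin n))) (f fbar : EuclideanSpace ℝ (Fin n) → ℝ)
    (m Λ r₁ h₁ : ℝ)
    (hf : GraphPMT.EntireOrMinimalBoundary (n + 1) Ω f)
    (hAF : GraphPMT.AsymptoticallyFlat f)
    (hmass : GraphPMT.HasADMMass f m) (hm : 0 < m)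
    (hR : ∀ x ∈ (closure Ω)ᶜ, 0 ≤ GraphPMT.scalarCurvature (GraphPMT.graphMetric f) x)
    (hH : GraphPMT.MeanCurvaturePointsUpward f (closure Ω)ᶜ)
    (hS₃ : n = 3 → (fun x : EuclideanSpace ℝ (Fin n) =>
        f x - (Λ + GraphPMT.schwarzschild n m ‖x‖))
      =o[Bornology.cobounded (EuclideanSpace ℝ (Fin n))] fun x => ‖x‖ ^ (1 / 2 : ℝ))
    (hS₄ : n = 4 → (fun x : EuclideanSpace ℝ (Fin n) =>
        f x - (Λ + GraphPMT.schwarzschild n m ‖x‖))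
      =o[Bornology.cobounded (EuclideanSpace ℝ (Fin n))] fun x => Real.log ‖x‖)
    (hfbar : GraphPMT.IsConstantExtension Ω f fbar)
    (hr₁ : (2 * m) ^ (1 / ((n : ℝ) - 2)) < r₁)
    (hh₁ : Metric.ball (0 : EuclideanSpace ℝ (Fin n)) r₁ ⊆ GraphPMT.sublevel fbar h₁) :
    ∀ x ∉ Metric.ball (0 : EuclideanSpace ℝ (Fin n)) r₁,
      fbar x - h₁ ≤ GraphPMT.schwarzschild n m ‖x‖ - GraphPMT.schwarzschild n m r₁ := by
  intro x hx
  have hx' : r₁ ≤ ‖x‖ := by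
    rwa [mem_ball_zero_iff, not_lt] at hx
  obtain ⟨hr0, hr⟩ := GraphPMT.two_mul_lt_pow hn hm hr₁
  have hcone : ∀ y ∈ (closure Ω)ᶜ, GraphPMT.GardingCone (GraphPMT.sqrtInv (GraphPMT.gradVec f y) *
      GraphPMT.hess f y * GraphPMT.sqrtInv (GraphPMT.gradVec f y)) := fun y hy =>
    GraphPMT.gardingCone_hess ((hf.contDiffAt hy).of_le (by norm_cast; omega)) (hR y hy)
      (hH.1 y hy)
  -- compare with `l` times the profile of mass `m / l³`, whose growth rate is larger by the
  -- factor `l^(-1/2)`, and let `l → 1`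
  have hlim := ((GraphPMT.tendsto_scaled_schwarzschild (n := n) hm (hr0.trans_le hx')).sub
    (GraphPMT.tendsto_scaled_schwarzschild (n := n) hm hr0)).mono_left
      (nhdsWithin_le_nhds (s := Set.Iio 1))
  refine ge_of_tendsto hlim ?_
  have hM : Tendsto (fun l : ℝ => 2 * (m / l ^ 3)) (𝓝 1) (𝓝 (2 * m)) := by
    have : ContinuousAt (fun l : ℝ => 2 * (m / l ^ 3)) 1 :=
      continuousAt_const.mul (continuousAt_const.div (continuousAt_id.pow 3) (by norm_num))
    simpa using this.tendsto
  filter_upwards [nhdsWithin_le_nhds (hM.eventually (gt_mem_nhds hr)),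
    Ioo_mem_nhdsLT (zero_lt_one' ℝ)] with l hlr ⟨hl0, hl1⟩
  have hlM : m < l ^ 2 * (m / l ^ 3) := by
    have : l ^ 2 * (m / l ^ 3) = m / l := by field_simp
    rw [this, lt_div_iff₀ hl0]
    nlinarith
  have := GraphPMT.le_scaled_schwarzschild hn hf hm (by positivity) hl0 hl1 hlM hcone hS₃ hS₄
    hfbar hr0 hlr hh₁ hx'
  linarith
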